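/- Let $k\ge 0$ and $0<\alpha\le 1$. For $x=(x_1,x_2)\in\mathbb R^2$ and $\tau>0$ put $$E^k_\alpha(x;\tau)=\sum_{m=0}^\infty\frac{\{\tau(x_1+ix_2)\}^m}{\Gamma(\alpha m+1)}\,\hat J_m(k|x|),\qquad \hat J_m(t)=\left(\frac2t\right)^m m!\,J_m(t)\ (t\ne 0),\quad \hat J_m(0)=1,$$ where $J_m(t)=\left(\frac t2\right)^m\sum_{n=0}^\infty\frac{(-1)^n}{(m+n)!\,n!}\left(\frac t2\right)^{2n}$ is the Bessel function of order $m$. Let $C(\pi\alpha/2)=\{x\in\mathbb R^2 : x_1>|x|\cos(\pi\alpha/2)\}$. Then: 1. For every regular $C^2$ curve $c$ (the image of a $C^2$ map with nowhere vanishing derivative on an interval of positive length) with $\overline c\subset C(\pi\alpha/2)$, $$\lim_{\tau\to\infty}\|E^k_\alpha(\cdot;\tau)|_c\|_{L^2(c)}=\infty,$$ where $L^2(c)$ is taken with respect to arc length (one-dimensional Hausdorff measure on $c$), and the norm is allowed to take the value $\infty$. 2. For every bounded open set $U\subset\mathbb R^2$ with $\overline U\subset\mathbb R^2\setminus\overline{C(\pi\alpha/2)}$,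 one has $E^k_\alpha(\cdot;\tau)\in H^1(U)$ for every $\tau>0$, and $$\lim_{\tau\to\infty}\|E^k_\alpha(\cdot;\tau)\|_{H^1(U)}=0,$$ where $\|u\|_{H^1(U)}^2=\|u\|_{L^2(U)}^2+\sum_{j=1}^2\|\partial_ju\|_{L^2(U)}^2$ with weak partial derivatives. -/

import Mathlib

open MeasureTheory Filter Topology
open scoped ENNReal

noncomputable section

namespace VekuaMittagLeffler

/-- The Euclidean plane. -/
abbrev Plane : Type := EuclideanSpace ℝ (Fin 2)

/-- The Bessel function of the first kind of integer order `m ≥ 0`. -/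
def besselJ (m : ℕ) (t : ℝ) : ℝ :=
  (t / 2) ^ m *
    ∑' n : ℕ, ((-1) ^ n / ((Nat.factorial (m + n) : ℝ) * (Nat.factorial n : ℝ))) * (t / 2) ^ (2 * n)

/-- The normalized Bessel function `(2 / t) ^ m * m! * J_m(t)`, extended to `t = 0` by its limit,
which is `1`. -/
def besselJhat (m : ℕ) (t : ℝ) : ℝ :=
  if t = 0 then 1 else (2 / t) ^ m * (Nat.factorial m : ℝ) * besselJ m t

/-- The modified Mittag-Leffler function
`E^k_α(x; τ) = ∑ m, (τ (x₁ + i x₂)) ^ m / Γ(α m + 1) * (2 / (k|x|)) ^ m * m! * J_m(k|x|)`. -/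
def modifiedML (k α τ : ℝ) (x : Plane) : ℂ :=
  ∑' m : ℕ, ((τ : ℂ) * ((x 0 : ℂ) + Complex.I * (x 1 : ℂ))) ^ m
    / (Real.Gamma (α * m + 1) : ℂ) * (besselJhat m (k * ‖x‖) : ℂ)

/-- The open cone with vertex `y`, axis direction `ω` and half opening angle `θ`. -/
def openCone (y ω : Plane) (θ : ℝ) : Set Plane :=
  {x | ‖x - y‖ * Real.cos θ < inner ℝ (x - y) ω}

/-- The open cone `C(θ)` with vertex at the origin about the positive `x₁`-axis. -/
def axisCone (θ : ℝ) : Set Plane :=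
  openCone 0 (EuclideanSpace.single 0 1) θ

/-- `c` is a regular `C²` curve: the trace of a `C²` map with nowhere vanishing velocity on a
nondegenerate interval (open, closed or half-open, bounded or not; velocities at endpoints
belonging to the interval are one-sided). -/
def IsRegularC2Curve (c : Set Plane) : Prop :=
  ∃ (I : Set ℝ) (γ : ℝ → Plane), I.OrdConnected ∧ (interior I).Nonempty ∧
    ContDiffOn ℝ 2 γ I ∧ (∀ t ∈ I, derivWithin γ I t ≠ 0) ∧ γ '' I = c

/-- The norm of `L²(c)`, with respect to arc length (one-dimensional Hausdorff measure) on `c`. -/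
def curveL2Norm (c : Set Plane) (u : Plane → ℂ) : ℝ≥0∞ :=
  eLpNorm u 2 ((Measure.hausdorffMeasure 1 : Measure Plane).restrict c)

/-- `v` is the weak partial derivative of `u` on `U` in the `j`-th coordinate direction. -/
def IsWeakPartialDeriv (U : Set Plane) (j : Fin 2) (u v : Plane → ℂ) : Prop :=
  LocallyIntegrableOn u U volume ∧ LocallyIntegrableOn v U volume ∧
    ∀ φ : Plane → ℂ, ContDiff ℝ ((⊤ : ℕ∞) : WithTop ℕ∞) φ → HasCompactSupport φ → tsupport φ ⊆ U →
      ∫ x in U, u x * fderiv ℝ φ x (EuclideanSpace.single j 1) = - ∫ x in U, v x * φ x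

/-- `u ∈ L²(U)` has the weak gradient `v ∈ L²(U)²`. -/
def HasL2WeakGradient (U : Set Plane) (u : Plane → ℂ) (v : Fin 2 → Plane → ℂ) : Prop :=
  MemLp u 2 (volume.restrict U) ∧
    ∀ j, MemLp (v j) 2 (volume.restrict U) ∧ IsWeakPartialDeriv U j u (v j)

/-- The norm of `H¹(U)` as an extended nonnegative real: since weak gradients are unique almost
everywhere, the infimum is over a single value if `u ∈ H¹(U)`; it is `∞` if `u ∉ H¹(U)`. -/
def sobolevH1Norm (U : Set Plane) (u : Plane → ℂ) : ℝ≥0∞ :=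
  ⨅ (v : Fin 2 → Plane → ℂ) (_ : HasL2WeakGradient U u v),
    (eLpNorm u 2 (volume.restrict U) ^ 2
      + ∑ j, eLpNorm (v j) 2 (volume.restrict U) ^ 2) ^ (1 / 2 : ℝ)

end VekuaMittagLeffler

end

/-! Since Γ(αm+1) sits in the denominator, the model case is the classical Mittag-Leffler function
E_α, and k only enters through a Vekua transform. By the Beta integral, each normalized Bessel
function is `1 + ∫₀¹ s^m K(s) ds`, with a kernel K that does not depend on m. Summing over m gives,
with z = x₁ + i x₂, E^k_α(x;τ) = E_α(τz) + ∫₀¹ E_α(tτz) K(t) dt (`modifiedML_eq`), where K is smooth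
in x and t.

The asymptotics of E_α come from Hankel's formula for 1/Γ, written in the coordinate w = log s, in
which the contour bounds a half strip. Summing a geometric series represents 2πi E_α(z) as the
integral of exp(e^w)/(1 - z e^{-αw}), and the contour is then pushed to re w = -∞. If |arg z| ≥ ψ >
πα/2, no pole is crossed, so E_α(z) = O(1/|z|) (`exists_norm_mittagLeffler_le_div`). If z = e^{αw₀}
with |im w₀| < π/2, the pole is removed by subtracting α⁻¹ times the kernel of order 1 with the same
pole. As E_1 = exp, the difference E_α(z) - α⁻¹ exp(z^{1/α}) stays bounded on each ray
(`exists_norm_mittagLeffler_sub_exp_le`).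

Inside the cone E_α(τz) therefore grows like e^S with S a positive multiple of τ^{1/α}, while the
integral term is only O(e^S/S) + O(1). So |E^k_α(x;τ)| → ∞ pointwise, and Fatou's lemma on a set of
positive length gives the first claim. Away from the closed cone, the decay of E_α and a Cauchy
estimate for its derivative give uniform C¹ bounds of order τ^{-1/2} on compact sets
(`exists_bound_modifiedML`), hence decay in H¹. -/

noncomputable section

namespace VekuaMittagLeffler

/-! ### Integrals over Hankel contours in the logarithmic coordinate -/

section Hankel

open Complex Set

/-- The integral of `f` along the boundary of the half strip `{w | ρ < re w, |im w| < φ}`, run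
through from `+∞ - iφ` to `+∞ + iφ`. Under `w ↦ exp w` this is a Hankel contour. -/
def hankelIntegral (φ ρ : ℝ) (f : ℂ → ℂ) : ℂ :=
  (∫ x : ℝ in Ioi ρ, f (x + φ * I)) - (∫ x : ℝ in Ioi ρ, f (x + (-φ : ℝ) * I))
    + I * ∫ y : ℝ in (-φ)..φ, f (ρ + y * I)

variable {φ ρ : ℝ} {f g : ℂ → ℂ}

theorem hankelIntegral_congr (hφ : 0 < φ) (h : ∀ w : ℂ, ρ ≤ w.re → |w.im| ≤ φ → f w = g w) :
    hankelIntegral φ ρ f = hankelIntegral φ ρ g := by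
  unfold hankelIntegral
  congr 1
  · congr 1
    · refine setIntegral_congr_fun measurableSet_Ioi fun x hx => h _ ?_ ?_
      · simpa using (mem_Ioi.1 hx).le
      · simp [abs_of_pos hφ]
    · refine setIntegral_congr_fun measurableSet_Ioi fun x hx => h _ ?_ ?_
      · simpa using (mem_Ioi.1 hx).le
      · simp [abs_of_pos hφ]
  · congr 1
    refine intervalIntegral.integral_congr fun y hy => h _ ?_ ?_
    · simp
    · rw [uIcc_of_le (by linarith)] at hy
      simpa [abs_le] using hy

/-- The two contours differ by the boundary of a rectangle, where Cauchy's theorem applies. -/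
theorem hankelIntegral_shift {ρ' : ℝ} (hφ : 0 < φ) (hρ : ρ' ≤ ρ)
    (hf : ∀ w : ℂ, ρ' ≤ w.re → |w.im| ≤ φ → DifferentiableAt ℂ f w)
    (hu : IntegrableOn (fun x : ℝ => f (x + φ * I)) (Ioi ρ'))
    (hl : IntegrableOn (fun x : ℝ => f (x + (-φ : ℝ) * I)) (Ioi ρ')) :
    hankelIntegral φ ρ f = hankelIntegral φ ρ' f := by
  have key := integral_boundary_rect_eq_zero_of_differentiableOn f ⟨ρ', -φ⟩ ⟨ρ, φ⟩ (by
    intro w hw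
    rw [mem_reProdIm, uIcc_of_le hρ, uIcc_of_le (by linarith)] at hw
    exact (hf w hw.1.1 (abs_le.2 hw.2)).differentiableWithinAt)
  simp only [smul_eq_mul] at key
  have e1 := intervalIntegral.integral_Ioi_sub_Ioi hu hρ
  have e2 := intervalIntegral.integral_Ioi_sub_Ioi hl hρ
  unfold hankelIntegral
  rw [← e1, ← e2] at key
  linear_combination key

/-- Moving the vertical side to -∞ makes it vanish, because it has fixed length 2φ and the integrand
is at most M there. Only the two full horizontal lines survive. -/
theorem hankelIntegral_eq_sub_of_tendsto {M : ℝ → ℝ} (hφ : 0 < φ)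
    (hf : ∀ w : ℂ, |w.im| ≤ φ → DifferentiableAt ℂ f w)
    (hu : Integrable (fun x : ℝ => f (x + φ * I)))
    (hl : Integrable (fun x : ℝ => f (x + (-φ : ℝ) * I)))
    (hM : ∀ᶠ x : ℝ in atBot, ∀ y : ℝ, |y| ≤ φ → ‖f (x + y * I)‖ ≤ M x)
    (hM0 : Tendsto M atBot (𝓝 0)) :
    hankelIntegral φ ρ f = (∫ x : ℝ, f (x + φ * I)) - ∫ x : ℝ, f (x + (-φ : ℝ) * I) := by
  have h1 : Tendsto (fun r => hankelIntegral φ r f) atBot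
      (𝓝 ((∫ x : ℝ, f (x + φ * I)) - (∫ x : ℝ, f (x + (-φ : ℝ) * I)) + I * 0)) := by
    refine ((AECover.integral_tendsto_of_countably_generated (aecover_Ioi tendsto_id) hu).sub
      (AECover.integral_tendsto_of_countably_generated (aecover_Ioi tendsto_id) hl)).add
      (Tendsto.const_mul _ ?_)
    refine squeeze_zero_norm' (a := fun x => M x * (φ + φ)) ?_ (by simpa using hM0.mul_const _)
    filter_upwards [hM] with x hx
    refine (intervalIntegral.norm_integral_le_of_norm_le_const (C := M x) fun y hy => hx y ?_).trans
      ?_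
    · rw [uIoc_of_le (by linarith)] at hy
      exact abs_le.2 ⟨hy.1.le, hy.2⟩
    · rw [sub_neg_eq_add, abs_of_pos (by linarith)]
  rw [mul_zero, add_zero] at h1
  refine tendsto_nhds_unique (Tendsto.congr' ?_ tendsto_const_nhds) h1
  filter_upwards [eventually_le_atBot ρ] with r hr
  exact hankelIntegral_shift hφ hr (fun w _ => hf w) hu.integrableOn hl.integrableOn

/-- The primitive telescopes along the three sides and vanishes at both infinite ends. -/
theorem hankelIntegral_deriv_eq_zero {F : ℂ → ℂ} (hF : ∀ w, HasDerivAt F (f w) w)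
    (hc : Continuous f)
    (hu : IntegrableOn (fun x : ℝ => f (x + φ * I)) (Ioi ρ))
    (hl : IntegrableOn (fun x : ℝ => f (x + (-φ : ℝ) * I)) (Ioi ρ))
    (hu0 : Tendsto (fun x : ℝ => F (x + φ * I)) atTop (𝓝 0))
    (hl0 : Tendsto (fun x : ℝ => F (x + (-φ : ℝ) * I)) atTop (𝓝 0)) :
    hankelIntegral φ ρ f = 0 := by
  have hline : ∀ (b x : ℝ), HasDerivAt (fun x : ℝ => F (x + b * I)) (f (x + b * I)) x := by
    intro b x
    have h2 : HasDerivAt (fun x : ℝ => (x : ℂ) + b * I) 1 x := by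
      simpa using (ofRealCLM.hasDerivAt (x := x)).add_const (b * I : ℂ)
    have h3 := (hF (x + b * I)).comp x h2
    rwa [mul_one] at h3
  have hvert : ∀ y : ℝ, HasDerivAt (fun y : ℝ => F (ρ + y * I)) (f (ρ + y * I) * I) y := by
    intro y
    have h2 : HasDerivAt (fun y : ℝ => (ρ : ℂ) + y * I) I y := by
      simpa using ((ofRealCLM.hasDerivAt (x := y)).mul_const I).const_add (ρ : ℂ)
    exact (hF (ρ + y * I)).comp y h2
  have e1 := integral_Ioi_of_hasDerivAt_of_tendsto (hline φ ρ).continuousAt.continuousWithinAt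
    (fun x _ => hline φ x) hu hu0
  have e2 := integral_Ioi_of_hasDerivAt_of_tendsto (hline (-φ) ρ).continuousAt.continuousWithinAt
    (fun x _ => hline (-φ) x) hl hl0
  have e3 := intervalIntegral.integral_eq_sub_of_hasDerivAt (a := -φ) (b := φ)
    (fun y _ => hvert y) (by apply Continuous.intervalIntegrable; fun_prop)
  rw [intervalIntegral.integral_mul_const] at e3
  unfold hankelIntegral
  rw [e1, e2]
  linear_combination e3

theorem tendsto_hankelIntegral {ι : Type*} {l : Filter ι} [l.IsCountablyGenerated]
    {F : ι → ℂ → ℂ} {G : ℂ → ℝ} (hφ : 0 < φ) (hF : ∀ i, Continuous (F i)) (hG : Continuous G)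
    (hGu : IntegrableOn (fun x : ℝ => G (x + φ * I)) (Ioi ρ))
    (hGl : IntegrableOn (fun x : ℝ => G (x + (-φ : ℝ) * I)) (Ioi ρ))
    (hb : ∀ᶠ i in l, ∀ w : ℂ, ρ ≤ w.re → |w.im| ≤ φ → ‖F i w‖ ≤ G w)
    (ht : ∀ w : ℂ, ρ ≤ w.re → |w.im| ≤ φ → Tendsto (fun i => F i w) l (𝓝 (f w))) :
    Tendsto (fun i => hankelIntegral φ ρ (F i)) l (𝓝 (hankelIntegral φ ρ f)) := by
  have hline : ∀ b : ℝ, |b| = φ → IntegrableOn (fun x : ℝ => G (x + b * I)) (Ioi ρ) →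
      Tendsto (fun i => ∫ x : ℝ in Ioi ρ, F i (x + b * I)) l
        (𝓝 (∫ x : ℝ in Ioi ρ, f (x + b * I))) := by
    intro b hb' hGb
    refine tendsto_integral_filter_of_dominated_convergence (fun x : ℝ => G (x + b * I))
      (Eventually.of_forall fun i => ?_) ?_ hGb ?_
    · exact ((hF i).comp (by fun_prop)).aestronglyMeasurable
    · filter_upwards [hb] with i hi
      refine (ae_restrict_iff' measurableSet_Ioi).2 (ae_of_all _ fun x hx => hi _ ?_ ?_)
      · simpa using (mem_Ioi.1 hx).le
      · simp [hb']
    · refine (ae_restrict_iff' measurableSet_Ioi).2 (ae_of_all _ fun x hx => ht _ ?_ ?_)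
      · simpa using (mem_Ioi.1 hx).le
      · simp [hb']
  refine ((hline φ (abs_of_pos hφ) hGu).sub (hline (-φ) (by simp [abs_of_pos hφ]) hGl)).add
    (Tendsto.const_mul _ ?_)
  refine intervalIntegral.tendsto_integral_filter_of_dominated_convergence
    (fun y : ℝ => G (ρ + y * I)) (Eventually.of_forall fun i => ?_) ?_ ?_ ?_
  · exact ((hF i).comp (by fun_prop)).aestronglyMeasurable
  · filter_upwards [hb] with i hi
    refine ae_of_all _ fun y hy => hi _ (by simp) ?_
    rw [uIoc_of_le (by linarith)] at hy
    simpa [abs_le] using ⟨hy.1.le, hy.2⟩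
  · apply Continuous.intervalIntegrable; fun_prop
  · refine ae_of_all _ fun y hy => ht _ (by simp) ?_
    rw [uIoc_of_le (by linarith)] at hy
    simpa [abs_le] using ⟨hy.1.le, hy.2⟩

theorem hankelIntegral_sum {ι : Type*} (s : Finset ι) {F : ι → ℂ → ℂ} (hF : ∀ i, Continuous (F i))
    (hu : ∀ i, IntegrableOn (fun x : ℝ => F i (x + φ * I)) (Ioi ρ))
    (hl : ∀ i, IntegrableOn (fun x : ℝ => F i (x + (-φ : ℝ) * I)) (Ioi ρ)) :
    hankelIntegral φ ρ (fun w => ∑ i ∈ s, F i w) = ∑ i ∈ s, hankelIntegral φ ρ (F i) := by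
  unfold hankelIntegral
  rw [integral_finsetSum _ fun i _ => hu i, integral_finsetSum _ fun i _ => hl i,
    intervalIntegral.integral_finsetSum (f := fun i (y : ℝ) => F i (ρ + y * I)) fun i _ =>
      Continuous.intervalIntegrable (by fun_prop) _ _]
  rw [Finset.sum_add_distrib, Finset.sum_sub_distrib, Finset.mul_sum]

theorem hankelIntegral_const_mul (c : ℂ) :
    hankelIntegral φ ρ (fun w => c * f w) = c * hankelIntegral φ ρ f := by
  unfold hankelIntegral
  rw [integral_const_mul, integral_const_mul, intervalIntegral.integral_const_mul]
  ring

theorem hankelIntegral_sub (hf : ContinuousOn f {w | w.re = ρ ∧ |w.im| ≤ φ})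
    (hg : ContinuousOn g {w | w.re = ρ ∧ |w.im| ≤ φ}) (hφ : 0 < φ)
    (hfu : IntegrableOn (fun x : ℝ => f (x + φ * I)) (Ioi ρ))
    (hfl : IntegrableOn (fun x : ℝ => f (x + (-φ : ℝ) * I)) (Ioi ρ))
    (hgu : IntegrableOn (fun x : ℝ => g (x + φ * I)) (Ioi ρ))
    (hgl : IntegrableOn (fun x : ℝ => g (x + (-φ : ℝ) * I)) (Ioi ρ)) :
    hankelIntegral φ ρ (fun w => f w - g w) = hankelIntegral φ ρ f - hankelIntegral φ ρ g := by
  unfold hankelIntegral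
  have h : ∀ {h : ℂ → ℂ}, ContinuousOn h {w | w.re = ρ ∧ |w.im| ≤ φ} →
      IntervalIntegrable (fun y : ℝ => h (ρ + y * I)) volume (-φ) φ := by
    intro h hh
    refine ContinuousOn.intervalIntegrable (hh.comp (by fun_prop) fun y hy => ?_)
    rw [uIcc_of_le (by linarith)] at hy
    simpa [abs_le] using hy
  rw [integral_sub hfu hgu, integral_sub hfl hgl, intervalIntegral.integral_sub (h hf) (h hg)]
  ring

end Hankel

/-! ### Hankel's formula for 1/Γ -/

section HankelGamma

open Complex Set

theorem tendsto_exp_neg_mul_exp_mul_exp_atTop {c : ℝ} (hc : 0 < c) (p : ℝ) :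
    Tendsto (fun x : ℝ => Real.exp (-(c * Real.exp x)) * Real.exp (p * x)) atTop (𝓝 0) := by
  have h := (tendsto_rpow_mul_exp_neg_mul_atTop_nhds_zero p c hc).comp Real.tendsto_exp_atTop
  refine h.congr fun x => ?_
  simp only [Function.comp]
  rw [← Real.exp_mul, mul_comm x p, mul_comm, neg_mul]

theorem integrableOn_exp_neg_mul_exp_mul_exp {c : ℝ} (hc : 0 < c) (p ρ : ℝ) :
    IntegrableOn (fun x : ℝ => Real.exp (-(c * Real.exp x)) * Real.exp (p * x)) (Ioi ρ) := by
  -- The spare factor e^x in the exponent p + 1 leaves e^{-x} as an integrable majorant.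
  have hg : Tendsto (fun x : ℝ => Real.exp (-(c * Real.exp x)) * Real.exp ((p + 1) * x)) atTop
      (𝓝 0) := tendsto_exp_neg_mul_exp_mul_exp_atTop hc (p + 1)
  refine integrable_of_isBigO_exp_neg one_pos (by fun_prop) ?_
  refine Asymptotics.IsBigO.of_bound 1 ?_
  filter_upwards [hg.eventually_le_const one_pos] with x hx
  rw [Real.norm_of_nonneg (by positivity), Real.norm_of_nonneg (by positivity), one_mul]
  have : Real.exp (p * x) = Real.exp ((p + 1) * x) * Real.exp (-1 * x) := by
    rw [← Real.exp_add]; congr 1; ring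
  rw [this, ← mul_assoc]
  exact mul_le_of_le_one_left (by positivity) hx

theorem integrable_exp_neg_mul_exp_mul_exp {c p : ℝ} (hc : 0 < c) (hp : 0 < p) :
    Integrable (fun x : ℝ => Real.exp (-(c * Real.exp x)) * Real.exp (p * x)) := by
  rw [← integrableOn_univ, ← Iic_union_Ioi (a := (0 : ℝ)), integrableOn_union]
  refine ⟨(integrableOn_exp_mul_Iic hp 0).mono' (by fun_prop) (ae_of_all _ fun x => ?_),
    integrableOn_exp_neg_mul_exp_mul_exp hc p 0⟩
  rw [Real.norm_of_nonneg (by positivity)]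
  refine mul_le_of_le_one_left (by positivity) (Real.exp_le_one_iff.2 ?_)
  have := Real.exp_pos x
  nlinarith

/-- Euler's integral after the substitution r = e^x. -/
theorem integral_exp_neg_exp_mul_exp {p : ℝ} (hp : 0 < p) :
    ∫ x : ℝ, Real.exp (-Real.exp x) * Real.exp (p * x) = Real.Gamma p := by
  have h := integral_image_eq_integral_abs_deriv_smul (MeasurableSet.univ)
    (fun x _ => (Real.hasDerivAt_exp x).hasDerivWithinAt) (Real.exp_injective.injOn)
    (fun r : ℝ => Real.exp (-r) * r ^ (p - 1))
  rw [image_univ, Real.range_exp, ← Real.Gamma_eq_integral hp] at h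
  rw [h, setIntegral_univ]
  refine integral_congr_ae (ae_of_all _ fun x => ?_)
  simp only [abs_of_pos (Real.exp_pos x), smul_eq_mul]
  rw [← Real.exp_mul, ← Real.exp_add, ← Real.exp_add, ← Real.exp_add]
  ring_nf

theorem norm_exp_exp (x b : ℝ) : ‖cexp (cexp (x + b * I))‖ = Real.exp (Real.exp x * Real.cos b) := by
  rw [norm_exp, exp_re]; simp

theorem norm_exp_neg_exp (x b : ℝ) :
    ‖cexp (-cexp (x + b * I))‖ = Real.exp (-(Real.cos b * Real.exp x)) := by
  rw [norm_exp, neg_re, exp_re]; simp [mul_comm]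

theorem norm_exp_real_mul (p x b : ℝ) : ‖cexp (p * (x + b * I))‖ = Real.exp (p * x) := by
  rw [norm_exp]; simp

/-- In the variable r = e^w this rotates the ray of Euler's integral. Cauchy's theorem is applied to
rectangles over [-T, T]; for |β| < π/2 the cosine stays positive, so the vertical sides vanish as T
→ ∞. -/
theorem integral_exp_neg_exp_mul_exp_horizontal {p β : ℝ} (hp : 0 < p) (hβ : |β| < Real.pi / 2) :
    ∫ x : ℝ, cexp (-cexp (x + β * I)) * cexp (p * (x + β * I)) = Real.Gamma p := by
  set g : ℂ → ℂ := fun w => cexp (-cexp w) * cexp (p * w) with hg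
  have hgn : ∀ x b : ℝ, ‖g (x + b * I)‖ =
      Real.exp (-(Real.cos b * Real.exp x)) * Real.exp (p * x) := fun x b => by
    simp only [hg]
    rw [norm_mul, norm_exp_neg_exp, norm_exp_real_mul]
  have hcos : ∀ b : ℝ, |b| ≤ |β| → Real.cos β ≤ Real.cos b := fun b hb => by
    rw [← Real.cos_abs b, ← Real.cos_abs β]
    exact Real.cos_le_cos_of_nonneg_of_le_pi (abs_nonneg _) (by linarith [Real.pi_pos]) hb
  have hc : 0 < Real.cos β := Real.cos_pos_of_mem_Ioo (by constructor <;> linarith [abs_lt.1 hβ])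
  have hint : ∀ b : ℝ, |b| ≤ |β| → Integrable (fun x : ℝ => g (x + b * I)) := fun b hb => by
    refine (integrable_exp_neg_mul_exp_mul_exp (hc.trans_le (hcos b hb)) hp).mono'
      (by fun_prop) (ae_of_all _ fun x => (hgn x b).le)
  have hvert : ∀ T : ℝ, ‖∫ y in (0 : ℝ)..β, g (T + y * I)‖ ≤
      Real.exp (-(Real.cos β * Real.exp T)) * Real.exp (p * T) * |β| := fun T => by
    have := intervalIntegral.norm_integral_le_of_norm_le_const (a := 0) (b := β)
      (f := fun y : ℝ => g (T + y * I))
      (C := Real.exp (-(Real.cos β * Real.exp T)) * Real.exp (p * T)) fun y hy => ?_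
    · simpa using this
    · rw [hgn]
      gcongr
      apply hcos
      rcases mem_uIoc.1 hy with h | h
      · rw [abs_of_pos h.1]; exact h.2.trans (le_abs_self _)
      · rw [abs_of_nonpos h.2]; exact (neg_le_neg h.1.le).trans (neg_le_abs _)
  have hv1 : Tendsto (fun T : ℝ => ∫ y in (0 : ℝ)..β, g (T + y * I)) atTop (𝓝 0) := by
    refine squeeze_zero_norm hvert ?_
    simpa using (tendsto_exp_neg_mul_exp_mul_exp_atTop hc p).mul_const |β|
  have hv2 : Tendsto (fun T : ℝ => ∫ y in (0 : ℝ)..β, g ((-T : ℝ) + y * I)) atTop (𝓝 0) := by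
    refine squeeze_zero_norm (a := fun T => Real.exp (-(p * T)) * |β|) (fun T => ?_) ?_
    · refine (hvert (-T)).trans ?_
      gcongr
      rw [mul_neg]
      refine mul_le_of_le_one_left (by positivity) (Real.exp_le_one_iff.2 ?_)
      have := Real.exp_pos (-T)
      nlinarith
    · have : Tendsto (fun T : ℝ => Real.exp (-(p * T))) atTop (𝓝 0) :=
        Real.tendsto_exp_neg_atTop_nhds_zero.comp (tendsto_id.const_mul_atTop hp)
      simpa using this.mul_const |β|
  have hrect : ∀ T : ℝ, (∫ x in (-T)..T, g (x + (0 : ℝ) * I)) - (∫ x in (-T)..T, g (x + β * I))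
      + I * (∫ y in (0 : ℝ)..β, g (T + y * I)) - I * (∫ y in (0 : ℝ)..β, g ((-T : ℝ) + y * I))
      = 0 := fun T =>
    integral_boundary_rect_eq_zero_of_differentiableOn g ⟨-T, 0⟩ ⟨T, β⟩
      (Differentiable.differentiableOn (by fun_prop))
  have hlim := (((intervalIntegral_tendsto_integral (hint 0 (by simp)) tendsto_neg_atTop_atBot
    tendsto_id).sub (intervalIntegral_tendsto_integral (hint β le_rfl) tendsto_neg_atTop_atBot
    tendsto_id)).add (hv1.const_mul I)).sub (hv2.const_mul I)
  have heq := tendsto_nhds_unique (tendsto_const_nhds.congr fun T => (hrect T).symm) hlim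
  have h0 : ∫ x : ℝ, g (x + (0 : ℝ) * I) = Real.Gamma p := by
    rw [← integral_exp_neg_exp_mul_exp hp, ← integral_complex_ofReal]
    refine integral_congr_ae (ae_of_all _ fun x => ?_)
    simp [hg]
  rw [h0] at heq
  simp only [mul_zero, add_zero, sub_zero] at heq
  exact (sub_eq_zero.1 heq.symm).symm

variable {φ : ℝ}

theorem integrableOn_hankelKernel {c : ℝ} (hc : Real.cos c < 0) (s ρ : ℝ) :
    IntegrableOn (fun x : ℝ => cexp (cexp (x + c * I)) * cexp (-s * (x + c * I))) (Ioi ρ) := by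
  refine (integrableOn_exp_neg_mul_exp_mul_exp (neg_pos.2 hc) (-s) ρ).mono' (by fun_prop)
    (ae_of_all _ fun x => ?_)
  rw [norm_mul, norm_exp_exp, ← ofReal_neg, norm_exp_real_mul]
  simp [mul_comm]

/-- For exponents p in (0, 1) the contour opens into two full lines. Each is a rotated Euler
integral, with phases e^{±iπp}, and their difference is turned into 1/Γ(1-p) by the reflection
formula. -/
theorem hankelIntegral_kernel_of_neg (hφ : Real.pi / 2 < φ) (hφ' : φ < Real.pi) (ρ : ℝ) {p : ℝ}
    (hp : 0 < p) (hp1 : p < 1) :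
    hankelIntegral φ ρ (fun w => cexp (cexp w) * cexp (p * w))
      = 2 * Real.pi * I * ((Real.Gamma (1 - p))⁻¹ : ℝ) := by
  have hcos : Real.cos φ < 0 := Real.cos_neg_of_pi_div_two_lt_of_lt hφ (by linarith)
  have hφ0 : 0 < φ := by linarith [Real.pi_pos]
  have hint : ∀ c : ℝ, Real.cos c < 0 →
      Integrable (fun x : ℝ => cexp (cexp (x + c * I)) * cexp (p * (x + c * I))) := by
    intro c hc
    refine (integrable_exp_neg_mul_exp_mul_exp (neg_pos.2 hc) hp).mono' (by fun_prop)
      (ae_of_all _ fun x => ?_)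
    rw [norm_mul, norm_exp_exp, norm_exp_real_mul]
    simp [mul_comm]
  -- Used with c = ±φ and d = ±π: shifting by iπ turns exp(e^w) into exp(-e^w) on a line within π/2
  -- of the real axis.
  have hrot : ∀ (c d : ℝ), (cexp (d * I) = -1) → |c - d| < Real.pi / 2 →
      ∫ x : ℝ, cexp (cexp (x + c * I)) * cexp (p * (x + c * I))
        = cexp (p * d * I) * Real.Gamma p := by
    intro c d hd hcd
    rw [← integral_exp_neg_exp_mul_exp_horizontal hp hcd, ← integral_const_mul]
    refine integral_congr_ae (ae_of_all _ fun x => ?_)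
    have e1 : cexp (x + c * I) = - cexp (x + (c - d : ℝ) * I) := by
      have : (x + c * I : ℂ) = (x + (c - d : ℝ) * I) + d * I := by push_cast; ring
      rw [this, exp_add, hd]; ring
    have e2 : cexp (p * (x + c * I)) = cexp (p * d * I) * cexp (p * (x + (c - d : ℝ) * I)) := by
      rw [← exp_add]; congr 1; push_cast; ring
    simp only
    rw [e1, e2]; ring
  rw [hankelIntegral_eq_sub_of_tendsto (M := fun x => Real.exp (Real.exp x) * Real.exp (p * x))
    hφ0 (fun w _ => by fun_prop) (hint φ hcos) (hint (-φ) (by rwa [Real.cos_neg]))]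
  · rw [hrot φ Real.pi exp_pi_mul_I (by rw [abs_lt]; constructor <;> linarith),
      hrot (-φ) (-Real.pi) (by push_cast; rw [neg_mul, exp_neg, exp_pi_mul_I]; norm_num)
        (by rw [abs_lt]; constructor <;> linarith), ← sub_mul]
    have hsin : Real.sin (Real.pi * p) ≠ 0 :=
      (Real.sin_pos_of_pos_of_lt_pi (by positivity) (by nlinarith [Real.pi_pos])).ne'
    have hG : (Real.Gamma (1 - p))⁻¹ = Real.Gamma p * Real.sin (Real.pi * p) / Real.pi := by
      have h1 := Real.Gamma_mul_Gamma_one_sub p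
      have h2 : Real.Gamma (1 - p) ≠ 0 := (Real.Gamma_pos_of_pos (by linarith)).ne'
      have := Real.pi_pos.ne'
      rw [eq_div_iff hsin] at h1
      rw [inv_eq_one_div, div_eq_div_iff h2 this]
      linarith
    have hsin2 : cexp (p * Real.pi * I) - cexp (p * (-Real.pi : ℝ) * I)
        = 2 * I * Real.sin (Real.pi * p) := by
      push_cast
      rw [Complex.sin, mul_comm (Real.pi : ℂ) p, mul_neg]
      linear_combination (-(cexp (-(p * Real.pi) * I) - cexp (p * Real.pi * I))) * I_mul_I
    rw [hsin2, hG]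
    have : (Real.pi : ℂ) ≠ 0 := ofReal_ne_zero.2 Real.pi_pos.ne'
    push_cast
    field_simp
  · refine Eventually.of_forall fun x y _ => ?_
    rw [norm_mul, norm_exp_exp, norm_exp_real_mul]
    gcongr
    exact mul_le_of_le_one_right (Real.exp_pos x).le (Real.cos_le_one y)
  · have h1 : Tendsto (fun x : ℝ => Real.exp (Real.exp x)) atBot (𝓝 (Real.exp 0)) :=
      (Real.continuous_exp.tendsto 0).comp Real.tendsto_exp_atBot
    have h2 : Tendsto (fun x : ℝ => Real.exp (p * x)) atBot (𝓝 0) :=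
      Real.tendsto_exp_atBot.comp (tendsto_id.const_mul_atBot hp)
    simpa using h1.mul h2

/-- Integration of the derivative of exp(e^w) e^{-sw}; this is the contour form of Γ(s+1) = sΓ(s).
-/
theorem hankelIntegral_kernel_sub_one (hφ : Real.pi / 2 < φ) (hφ' : φ < Real.pi) (ρ s : ℝ) :
    hankelIntegral φ ρ (fun w => cexp (cexp w) * cexp (-(s - 1 : ℝ) * w))
      = s * hankelIntegral φ ρ (fun w => cexp (cexp w) * cexp (-s * w)) := by
  have hcos : Real.cos φ < 0 := Real.cos_neg_of_pi_div_two_lt_of_lt hφ (by linarith)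
  have hcos' : Real.cos (-φ) < 0 := by rwa [Real.cos_neg]
  have hφ0 : 0 < φ := by linarith [Real.pi_pos]
  have h0 : ∀ c : ℝ, Real.cos c < 0 →
      Tendsto (fun x : ℝ => cexp (cexp (x + c * I)) * cexp (-s * (x + c * I))) atTop (𝓝 0) := by
    intro c hc
    rw [tendsto_zero_iff_norm_tendsto_zero]
    refine (tendsto_exp_neg_mul_exp_mul_exp_atTop (neg_pos.2 hc) (-s)).congr fun x => ?_
    rw [norm_mul, norm_exp_exp, ← ofReal_neg, norm_exp_real_mul]
    simp [mul_comm]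
  have hint : ∀ c : ℝ, Real.cos c < 0 → IntegrableOn (fun x : ℝ =>
      cexp (cexp (x + c * I)) * cexp (-(s - 1 : ℝ) * (x + c * I))
        - s * (cexp (cexp (x + c * I)) * cexp (-s * (x + c * I)))) (Ioi ρ) := fun c hc =>
    (integrableOn_hankelKernel hc _ ρ).sub ((integrableOn_hankelKernel hc _ ρ).const_mul _)
  have h := hankelIntegral_deriv_eq_zero (φ := φ) (ρ := ρ)
    (F := fun w => cexp (cexp w) * cexp (-s * w))
    (f := fun w => cexp (cexp w) * cexp (-(s - 1 : ℝ) * w)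
      - s * (cexp (cexp w) * cexp (-s * w))) (fun w => ?_) (by fun_prop)
    (hint φ hcos) (hint (-φ) hcos') (h0 φ hcos) (h0 (-φ) hcos')
  · rw [hankelIntegral_sub (f := fun w => cexp (cexp w) * cexp (-(s - 1 : ℝ) * w))
      (g := fun w => s * (cexp (cexp w) * cexp (-s * w))) (by fun_prop) (by fun_prop) hφ0
      (integrableOn_hankelKernel hcos _ ρ)
      (integrableOn_hankelKernel hcos' _ ρ) ((integrableOn_hankelKernel hcos _ ρ).const_mul _)
      ((integrableOn_hankelKernel hcos' _ ρ).const_mul _), hankelIntegral_const_mul] at h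
    exact sub_eq_zero.1 h
  · have h1 := (((hasDerivAt_exp w).cexp).mul ((hasDerivAt_const_mul (-(s : ℂ)) (x := w)).cexp))
    refine h1.congr_deriv ?_
    have : cexp (-(s - 1 : ℝ) * w) = cexp w * cexp (-s * w) := by
      rw [← exp_add]; congr 1; push_cast; ring
    rw [this]; ring

/-- The limit p → 0+ of the case 0 < p < 1, by dominated convergence; the majorant rests on e^{p re
w} ≤ 1 + e^{re w}. -/
theorem hankelIntegral_kernel_zero (hφ : Real.pi / 2 < φ) (hφ' : φ < Real.pi) (ρ : ℝ) :
    hankelIntegral φ ρ (fun w => cexp (cexp w)) = 2 * Real.pi * I := by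
  have hcos : Real.cos φ < 0 := Real.cos_neg_of_pi_div_two_lt_of_lt hφ (by linarith)
  have hφ0 : 0 < φ := by linarith [Real.pi_pos]
  have hG : ∀ c : ℝ, Real.cos c < 0 → IntegrableOn (fun x : ℝ => ‖cexp (cexp (x + c * I))‖ *
      (1 + ‖cexp (x + c * I)‖)) (Ioi ρ) := by
    intro c hc
    have h1 := (integrableOn_hankelKernel hc 0 ρ).norm.add (integrableOn_hankelKernel hc (-1) ρ).norm
    refine h1.congr (ae_of_all _ fun x => ?_)
    simp [mul_add]
  have h1 := tendsto_hankelIntegral (l := 𝓝[>] (0 : ℝ)) (φ := φ) (ρ := ρ)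
    (F := fun p w => cexp (cexp w) * cexp (p * w)) (f := fun w => cexp (cexp w))
    (G := fun w => ‖cexp (cexp w)‖ * (1 + ‖cexp w‖)) hφ0 (fun p => by fun_prop) (by fun_prop)
    (hG φ hcos) (hG (-φ) (by rwa [Real.cos_neg])) ?_ ?_
  · have h2 : Tendsto (fun p : ℝ => 2 * Real.pi * I * (((Real.Gamma (1 - p))⁻¹ : ℝ) : ℂ)) (𝓝[>] 0)
        (𝓝 (2 * Real.pi * I * (((Real.Gamma 1)⁻¹ : ℝ) : ℂ))) := by
      refine Tendsto.const_mul _ ((continuous_ofReal.tendsto _).comp (Tendsto.inv₀ ?_ (by simp)))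
      have hc : ContinuousAt Real.Gamma (1 - 0) := by
        rw [sub_zero]
        exact (Real.differentiableOn_Gamma_Ioi.differentiableAt (Ioi_mem_nhds one_pos)).continuousAt
      have : ContinuousAt (fun p : ℝ => Real.Gamma (1 - p)) 0 :=
        ContinuousAt.comp (f := fun p : ℝ => 1 - p) hc (by fun_prop)
      simpa using this.tendsto.mono_left nhdsWithin_le_nhds
    rw [Real.Gamma_one, inv_one, ofReal_one, mul_one] at h2
    refine tendsto_nhds_unique h1 (h2.congr' ?_)
    filter_upwards [Ioo_mem_nhdsGT (zero_lt_one (α := ℝ))] with p hp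
    exact (hankelIntegral_kernel_of_neg hφ hφ' ρ hp.1 hp.2).symm
  · filter_upwards [Ioo_mem_nhdsGT (zero_lt_one (α := ℝ))] with p hp w _ _
    rw [norm_mul]
    gcongr
    rw [norm_exp, norm_exp, re_ofReal_mul]
    rcases le_total w.re 0 with h | h
    · have : Real.exp (p * w.re) ≤ 1 :=
        Real.exp_le_one_iff.2 (mul_nonpos_of_nonneg_of_nonpos hp.1.le h)
      linarith [Real.exp_pos w.re]
    · have : Real.exp (p * w.re) ≤ Real.exp w.re :=
        Real.exp_le_exp.2 (mul_le_of_le_one_left h hp.2.le)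
      linarith
  · intro w _ _
    have : Continuous fun p : ℝ => cexp (cexp w) * cexp (p * w) := by fun_prop
    simpa using (this.tendsto 0).mono_left nhdsWithin_le_nhds

/-- **Hankel's formula** for the reciprocal Gamma function. -/
theorem hankelIntegral_kernel (hφ : Real.pi / 2 < φ) (hφ' : φ < Real.pi) (ρ : ℝ) {s : ℝ}
    (hs : -1 < s) :
    hankelIntegral φ ρ (fun w => cexp (cexp w) * cexp (-s * w))
      = 2 * Real.pi * I * ((Real.Gamma (s + 1))⁻¹ : ℝ) := by
  -- Induction on an integer bound for s: the base case is -1 < s ≤ 0, and for s > n the recursion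
  -- lowers s by one.
  obtain ⟨n, hn⟩ := exists_nat_ge s
  induction n generalizing s with
  | zero =>
    rcases (show s ≤ 0 by simpa using hn).lt_or_eq with h | rfl
    · have := hankelIntegral_kernel_of_neg hφ hφ' ρ (p := -s) (by linarith) (by linarith)
      rw [sub_neg_eq_add, add_comm 1 s] at this
      simpa using this
    · simpa using hankelIntegral_kernel_zero hφ hφ' ρ
  | succ n ih =>
    by_cases h : s ≤ n
    · exact ih hs h
    · have hs0 : 0 < s := lt_of_le_of_lt n.cast_nonneg (not_le.1 h)
      have h1 := ih (s := s - 1) (by linarith) (by push_cast at hn; linarith)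
      rw [hankelIntegral_kernel_sub_one hφ hφ', sub_add_cancel] at h1
      rw [Real.Gamma_add_one hs0.ne', mul_inv]
      have : (s : ℂ) ≠ 0 := ofReal_ne_zero.2 hs0.ne'
      rw [← mul_right_inj' this, h1]
      push_cast
      field_simp

end HankelGamma

/-! ### The contour integral for the Mittag-Leffler function -/

section MittagLeffler

open Complex Set

/-- The Mittag-Leffler function `E_α(z) = ∑ m, z ^ m / Γ(α m + 1)`. -/
def mittagLeffler (α : ℝ) (z : ℂ) : ℂ :=
  ∑' m : ℕ, z ^ m / (Real.Gamma (α * m + 1) : ℂ)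

/-- The integrand of the Hankel contour integral that represents `2πi E_α(z)`, in the logarithmic
coordinate. -/
def mittagLefflerKernel (α : ℝ) (z w : ℂ) : ℂ :=
  cexp (cexp w) * (1 - z * cexp (-α * w))⁻¹

variable {φ ρ α : ℝ} {z w : ℂ}

theorem norm_mul_exp_neg (α : ℝ) (z w : ℂ) :
    ‖z * cexp (-α * w)‖ = ‖z‖ * Real.exp (-(α * w.re)) := by
  rw [norm_mul, norm_exp]; simp

/-- The condition on ρ keeps |z e^{-αw}| ≤ q < 1 on the whole contour, so the geometric series may
be integrated term by term, and Hankel's formula evaluates each term. -/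
theorem hasSum_hankelIntegral_mittagLefflerKernel (hφ : Real.pi / 2 < φ) (hφ' : φ < Real.pi)
    (hα : 0 < α) (hz : ‖z‖ < Real.exp (α * ρ)) :
    HasSum (fun m : ℕ => 2 * Real.pi * I * (z ^ m / (Real.Gamma (α * m + 1) : ℂ)))
      (hankelIntegral φ ρ (mittagLefflerKernel α z)) := by
  have hcos : Real.cos φ < 0 := Real.cos_neg_of_pi_div_two_lt_of_lt hφ (by linarith)
  have hcos' : Real.cos (-φ) < 0 := by rwa [Real.cos_neg]
  have hφ0 : 0 < φ := by linarith [Real.pi_pos]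
  set q : ℝ := ‖z‖ * Real.exp (-(α * ρ)) with hq
  have hq0 : 0 ≤ q := by positivity
  have hq1 : q < 1 := by
    rw [hq, Real.exp_neg, ← div_eq_mul_inv, div_lt_one (Real.exp_pos _)]; exact hz
  have hqw : ∀ w : ℂ, ρ ≤ w.re → ‖z * cexp (-α * w)‖ ≤ q := fun w hw => by
    rw [norm_mul_exp_neg, hq]
    gcongr
  set F : ℕ → ℂ → ℂ := fun m w => z ^ m * (cexp (cexp w) * cexp (-(α * m : ℝ) * w)) with hF
  have hF' : ∀ m w, F m w = cexp (cexp w) * (z * cexp (-α * w)) ^ m := fun m w => by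
    simp only [hF]
    rw [mul_pow, ← exp_nat_mul]
    have : (-(α * m : ℝ) * w : ℂ) = m * (-α * w) := by push_cast; ring
    rw [this]; ring
  have hFc : ∀ m, Continuous (F m) := fun m => by fun_prop
  have hFi : ∀ c : ℝ, Real.cos c < 0 → ∀ m,
      IntegrableOn (fun x : ℝ => F m (x + c * I)) (Ioi ρ) := fun c hc m =>
    (integrableOn_hankelKernel hc _ ρ).const_mul _
  have hH : ∀ m, hankelIntegral φ ρ (F m)
      = 2 * Real.pi * I * (z ^ m / (Real.Gamma (α * m + 1) : ℂ)) := fun m => by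
    have h0 : -1 < α * m := lt_of_lt_of_le (by norm_num) (by positivity : (0 : ℝ) ≤ α * m)
    have h1 := hankelIntegral_kernel hφ hφ' ρ h0
    simp only [hF]
    rw [hankelIntegral_const_mul, h1]
    push_cast
    ring
  have hG : ∀ c : ℝ, Real.cos c < 0 → IntegrableOn
      (fun x : ℝ => ‖cexp (cexp (x + c * I))‖ * (1 - q)⁻¹) (Ioi ρ) := fun c hc => by
    have h1 := (integrableOn_hankelKernel hc 0 ρ).norm.mul_const ((1 - q)⁻¹)
    refine h1.congr (ae_of_all _ fun x => by simp)
  have key := tendsto_hankelIntegral (l := atTop) (φ := φ) (ρ := ρ)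
    (F := fun (s : Finset ℕ) w => ∑ m ∈ s, F m w) (f := mittagLefflerKernel α z)
    (G := fun w => ‖cexp (cexp w)‖ * (1 - q)⁻¹) hφ0 (fun s => by fun_prop) (by fun_prop)
    (hG φ hcos) (hG (-φ) hcos') ?_ ?_
  · refine key.congr fun s => ?_
    rw [hankelIntegral_sum s hFc (hFi φ hcos) (hFi (-φ) hcos')]
    exact Finset.sum_congr rfl fun m _ => hH m
  · refine Eventually.of_forall fun s w hw _ => ?_
    simp only [hF']
    rw [← Finset.mul_sum, norm_mul]
    gcongr
    calc ‖∑ m ∈ s, (z * cexp (-α * w)) ^ m‖ ≤ ∑ m ∈ s, q ^ m := by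
          refine norm_sum_le_of_le _ fun m _ => ?_
          rw [norm_pow]
          exact pow_le_pow_left₀ (norm_nonneg _) (hqw w hw) m
      _ ≤ ∑' m, q ^ m := (summable_geometric_of_lt_one hq0 hq1).sum_le_tsum s
          fun m _ => by positivity
      _ = (1 - q)⁻¹ := tsum_geometric_of_lt_one hq0 hq1
  · intro w hw _
    have h1 := (hasSum_geometric_of_norm_lt_one ((hqw w hw).trans_lt hq1)).mul_left
      (cexp (cexp w))
    simp only [hF']
    exact h1

/-- Convergence is read off from the contour integral, without growth estimates for Γ. The angle
3π/4 is one admissible choice, and ρ is chosen so that e^{αρ} = ‖z‖ + 1. -/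
theorem summable_mittagLeffler (hα : 0 < α) (z : ℂ) :
    Summable fun m : ℕ => z ^ m / (Real.Gamma (α * m + 1) : ℂ) := by
  have h := hasSum_hankelIntegral_mittagLefflerKernel (φ := 3 / 4 * Real.pi)
    (ρ := Real.log (‖z‖ + 1) / α) (z := z)
    (by linarith [Real.pi_pos]) (by linarith [Real.pi_pos]) hα (by
      rw [mul_div_cancel₀ _ hα.ne', Real.exp_log (by positivity)]; linarith)
  exact (summable_mul_left_iff two_pi_I_ne_zero).1 h.summable

theorem hankelIntegral_mittagLefflerKernel (hφ : Real.pi / 2 < φ) (hφ' : φ < Real.pi)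
    (hα : 0 < α) (hz : ‖z‖ < Real.exp (α * ρ)) :
    hankelIntegral φ ρ (mittagLefflerKernel α z) = 2 * Real.pi * I * mittagLeffler α z := by
  rw [← (hasSum_hankelIntegral_mittagLefflerKernel hφ hφ' hα hz).tsum_eq, tsum_mul_left]
  rfl

theorem differentiable_tsum_mul_pow {a : ℕ → ℂ} (ha : ∀ r : ℝ, 0 ≤ r → Summable fun m => ‖a m‖ * r ^ m) :
    Differentiable ℂ fun z : ℂ => ∑' m, a m * z ^ m := by
  intro z
  refine (differentiableOn_tsum_of_summable_norm (U := Metric.ball 0 (‖z‖ + 1))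
    (ha (‖z‖ + 1) (by positivity)) (fun m => by fun_prop) Metric.isOpen_ball
    fun m w hw => ?_).differentiableAt (Metric.isOpen_ball.mem_nhds (by simp))
  rw [norm_mul, norm_pow]
  gcongr
  exact (mem_ball_zero_iff.1 hw).le

theorem differentiable_mittagLeffler (hα : 0 < α) : Differentiable ℂ (mittagLeffler α) := by
  have h := differentiable_tsum_mul_pow (a := fun m : ℕ => ((Real.Gamma (α * m + 1) : ℂ))⁻¹)
    fun r hr => by
      refine (summable_mittagLeffler hα (r : ℂ)).norm.congr fun m => ?_
      rw [norm_div, norm_pow, norm_real, norm_inv, Real.norm_of_nonneg hr]; ring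
  convert h using 2 with z
  unfold mittagLeffler
  exact tsum_congr fun m => by rw [div_eq_mul_inv, mul_comm]

theorem mittagLeffler_one (z : ℂ) : mittagLeffler 1 z = cexp z := by
  rw [exp_eq_exp_ℂ, NormedSpace.exp_eq_tsum_div]
  unfold mittagLeffler
  refine tsum_congr fun m => ?_
  rw [one_mul, Real.Gamma_nat_eq_factorial]; simp

/-! ### Distance from the pole to the contour, and decay outside the sector -/

theorem cos_le_cos_of_mem_Icc_two_pi_sub {δ v : ℝ} (hδ : 0 ≤ δ) (h1 : δ ≤ |v|)
    (h2 : |v| ≤ 2 * Real.pi - δ) : Real.cos v ≤ Real.cos δ := by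
  rw [← Real.cos_abs v]
  rcases le_total |v| Real.pi with h | h
  · exact Real.cos_le_cos_of_nonneg_of_le_pi hδ h h1
  · rw [← Real.cos_two_pi_sub |v|]
    exact Real.cos_le_cos_of_nonneg_of_le_pi hδ (by linarith) (by linarith)

/-- By the law of cosines the squared distance is at least t² - 2tR cos δ + R² = (t - R cos δ)² + R²
sin² δ. Under w ↦ e^{αw} horizontal lines become such rays, so this keeps the kernel's denominator
away from zero. -/
theorem sin_mul_le_norm_ray_sub {θ b δ t R : ℝ} (ht : 0 ≤ t) (hR : 0 ≤ R)
    (h : Real.cos (θ - b) ≤ Real.cos δ) :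
    Real.sin δ * R ≤ ‖(t * cexp (b * I) - R * cexp (θ * I) : ℂ)‖ := by
  have e : (t * cexp (b * I) - R * cexp (θ * I) : ℂ)
      = cexp (b * I) * (t - R * cexp ((θ - b : ℝ) * I)) := by
    rw [mul_sub, mul_left_comm _ (R : ℂ), ← exp_add]
    push_cast; ring_nf
  rw [e, norm_mul, norm_exp_ofReal_mul_I, one_mul]
  refine (le_abs_self _).trans (abs_le_of_sq_le_sq ?_ (norm_nonneg _))
  rw [← normSq_eq_norm_sq, normSq_apply, exp_mul_I, ← ofReal_cos, ← ofReal_sin]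
  simp only [sub_re, sub_im, mul_re, mul_im, add_re, add_im, ofReal_re, ofReal_im, I_re, I_im,
    mul_zero, zero_mul, sub_zero, add_zero, mul_one, zero_add, zero_sub]
  have h1 := Real.sin_sq_add_cos_sq (θ - b)
  have h2 := Real.sin_sq_add_cos_sq δ
  have h3 : t * R * Real.cos (θ - b) ≤ t * R * Real.cos δ := by gcongr
  have h4 : (Real.sin δ * R) ^ 2 = (1 - Real.cos δ ^ 2) * R ^ 2 := by
    rw [← h2]; ring
  have h5 : R ^ 2 * Real.sin (θ - b) ^ 2 = R ^ 2 * (1 - Real.cos (θ - b) ^ 2) := by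
    rw [← h1]; ring
  nlinarith [sq_nonneg (t - Real.cos δ * R)]

theorem one_sub_mul_exp_neg (α : ℝ) (z w : ℂ) :
    1 - z * cexp (-α * w) = cexp (-α * w) * (cexp (α * w) - z) := by
  rw [mul_sub, ← exp_add]
  simp [mul_comm]

/-- The bound for the integral of the Mittag-Leffler kernel along `im w = b` in terms of the
distance of the pole from this line. -/
def lineMass (α b : ℝ) : ℝ :=
  ∫ x : ℝ, Real.exp (-(-Real.cos b * Real.exp x)) * Real.exp (α * x)

theorem lineMass_nonneg (α b : ℝ) : 0 ≤ lineMass α b :=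
  integral_nonneg fun x => by positivity

theorem lineMass_neg (α b : ℝ) : lineMass α (-b) = lineMass α b := by
  simp [lineMass]

section Line

variable {b κ : ℝ}

theorem norm_mittagLefflerKernel_line_le (hκ : 0 < κ) (hz : z ≠ 0) (x : ℝ)
    (h : κ * ‖z‖ ≤ ‖cexp (α * (x + b * I)) - z‖) :
    ‖mittagLefflerKernel α z (x + b * I)‖
      ≤ Real.exp (-(-Real.cos b * Real.exp x)) * Real.exp (α * x) * (κ * ‖z‖)⁻¹ := by
  have hz' : 0 < ‖z‖ := norm_pos_iff.2 hz
  unfold mittagLefflerKernel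
  rw [one_sub_mul_exp_neg, mul_inv, ← exp_neg, norm_mul, norm_mul, norm_exp_exp, norm_inv,
    neg_mul, neg_neg, norm_exp_real_mul, ← mul_assoc, neg_mul, neg_neg, mul_comm (Real.cos b)]
  gcongr

theorem measurable_mittagLefflerKernel (α : ℝ) (z : ℂ) : Measurable (mittagLefflerKernel α z) := by
  unfold mittagLefflerKernel
  fun_prop

theorem integrable_mittagLefflerKernel_line (hα : 0 < α) (hb : Real.cos b < 0) (hκ : 0 < κ)
    (hz : z ≠ 0) (h : ∀ x : ℝ, κ * ‖z‖ ≤ ‖cexp (α * (x + b * I)) - z‖) :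
    Integrable fun x : ℝ => mittagLefflerKernel α z (x + b * I) := by
  refine ((integrable_exp_neg_mul_exp_mul_exp (neg_pos.2 hb) hα).mul_const
    (κ * ‖z‖)⁻¹).mono' ?_ (ae_of_all _ fun x => norm_mittagLefflerKernel_line_le hκ hz x (h x))
  exact ((measurable_mittagLefflerKernel α z).comp (by fun_prop)).aestronglyMeasurable

theorem norm_integral_mittagLefflerKernel_line_le (hα : 0 < α) (hb : Real.cos b < 0) (hκ : 0 < κ)
    (hz : z ≠ 0) (h : ∀ x : ℝ, κ * ‖z‖ ≤ ‖cexp (α * (x + b * I)) - z‖) :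
    ‖∫ x : ℝ, mittagLefflerKernel α z (x + b * I)‖ ≤ lineMass α b * (κ * ‖z‖)⁻¹ := by
  rw [lineMass, ← integral_mul_const]
  exact norm_integral_le_of_norm_le ((integrable_exp_neg_mul_exp_mul_exp (neg_pos.2 hb) hα).mul_const
    (κ * ‖z‖)⁻¹) (ae_of_all _ fun x => norm_mittagLefflerKernel_line_le hκ hz x (h x))

end Line

theorem tendsto_exp_exp_mul_inv_atBot (hα : 0 < α) {R : ℝ} (hR : 0 < R) :
    Tendsto (fun x : ℝ => Real.exp (Real.exp x) * (R * Real.exp (-(α * x)) - 1)⁻¹) atBot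
      (𝓝 0) := by
  have h1 : Tendsto (fun x : ℝ => Real.exp (Real.exp x)) atBot (𝓝 (Real.exp 0)) :=
    (Real.continuous_exp.tendsto 0).comp Real.tendsto_exp_atBot
  have h2 : Tendsto (fun x : ℝ => R * Real.exp (-(α * x)) - 1) atBot atTop := by
    refine tendsto_atTop_add_const_right _ _ (Tendsto.const_mul_atTop hR ?_)
    exact Real.tendsto_exp_atTop.comp
      (tendsto_neg_atBot_atTop.comp (tendsto_id.const_mul_atBot hα))
  simpa using h1.mul h2.inv_tendsto_atTop

theorem norm_mittagLefflerKernel_le (x y : ℝ) (h : 1 < ‖z‖ * Real.exp (-(α * x))) :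
    ‖mittagLefflerKernel α z (x + y * I)‖
      ≤ Real.exp (Real.exp x) * (‖z‖ * Real.exp (-(α * x)) - 1)⁻¹ := by
  unfold mittagLefflerKernel
  rw [norm_mul, norm_exp_exp, norm_inv]
  have h1 : ‖z * cexp (-α * (x + y * I))‖ = ‖z‖ * Real.exp (-(α * x)) := by
    rw [norm_mul_exp_neg]; simp
  have h2 := norm_sub_norm_le (z * cexp (-α * (x + y * I))) 1
  rw [norm_one, h1, norm_sub_rev] at h2
  have : 0 < ‖z‖ * Real.exp (-(α * x)) - 1 := by linarith
  gcongr
  exact mul_le_of_le_one_right (Real.exp_pos x).le (Real.cos_le_one y)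

theorem eventually_norm_mittagLefflerKernel_le (hα : 0 < α) (hz : z ≠ 0) :
    ∀ᶠ x : ℝ in atBot, ∀ y : ℝ, ‖mittagLefflerKernel α z (x + y * I)‖
      ≤ Real.exp (Real.exp x) * (‖z‖ * Real.exp (-(α * x)) - 1)⁻¹ := by
  have h2 : Tendsto (fun x : ℝ => ‖z‖ * Real.exp (-(α * x))) atBot atTop :=
    Tendsto.const_mul_atTop (norm_pos_iff.2 hz) (Real.tendsto_exp_atTop.comp
      (tendsto_neg_atBot_atTop.comp (tendsto_id.const_mul_atBot hα)))
  filter_upwards [h2.eventually_gt_atTop 1] with x hx y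
  exact norm_mittagLefflerKernel_le x y hx

theorem exp_real_mul_line (α x b : ℝ) :
    cexp (α * (x + b * I)) = (Real.exp (α * x) : ℝ) * cexp ((α * b : ℝ) * I) := by
  rw [ofReal_exp, ← exp_add]; push_cast; ring_nf

/-- The cone condition says |arg z| ≥ ψ. The kernel then has no pole in the strip |im w| ≤ φ, and
E_α(z) reduces to two line integrals whose denominators are at least a multiple of |z|. -/
theorem exists_norm_mittagLeffler_le_div (hα : 0 < α) {ψ : ℝ}
    (hψ : Real.pi * α / 2 < ψ) (hψ' : ψ ≤ Real.pi) :
    ∃ C : ℝ, 0 ≤ C ∧ ∀ z : ℂ, z ≠ 0 → z.re ≤ ‖z‖ * Real.cos ψ →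
      ‖mittagLeffler α z‖ ≤ C / ‖z‖ := by
  have hπ := Real.pi_pos
  -- φ > π/2 makes exp(e^w) decay along the lines, and αφ < ψ keeps the poles outside the strip.
  obtain ⟨φ, h1, h2⟩ := exists_between (show Real.pi / 2 < min Real.pi (ψ / α) by
    refine lt_min (by linarith) ?_
    rw [lt_div_iff₀ hα]; linarith)
  have hφπ := h2.trans_le (min_le_left _ _)
  have hφψ : α * φ < ψ := by
    have := h2.trans_le (min_le_right _ _)
    rw [lt_div_iff₀ hα] at this; linarith
  have hφ0 : 0 < φ := by linarith
  have hαφ : 0 < α * φ := by positivity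
  have hcos : Real.cos φ < 0 := Real.cos_neg_of_pi_div_two_lt_of_lt h1 (by linarith)
  have hcos' : Real.cos (-φ) < 0 := by rwa [Real.cos_neg]
  set κ := Real.sin (ψ - α * φ) with hκd
  have hκ : 0 < κ := Real.sin_pos_of_pos_of_lt_pi (by linarith) (by linarith)
  refine ⟨lineMass α φ * κ⁻¹, mul_nonneg (lineMass_nonneg _ _) (by positivity), fun z hz hre => ?_⟩
  have hz0 : 0 < ‖z‖ := norm_pos_iff.2 hz
  have harg : ψ ≤ |z.arg| := by
    by_contra! h
    have := Real.cos_lt_cos_of_nonneg_of_le_pi (abs_nonneg _) hψ' h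
    rw [Real.cos_abs] at this
    have h3 : z.re = ‖z‖ * Real.cos z.arg := (norm_mul_cos_arg z).symm
    nlinarith
  have hdist : ∀ b : ℝ, |b| = φ → ∀ x : ℝ, κ * ‖z‖ ≤ ‖cexp (α * (x + b * I)) - z‖ := by
    intro b hb x
    have hb' : |α * b| = α * φ := by rw [abs_mul, abs_of_pos hα, hb]
    rw [exp_real_mul_line]
    conv_rhs => rw [← norm_mul_exp_arg_mul_I z]
    refine sin_mul_le_norm_ray_sub (Real.exp_pos _).le (norm_nonneg _)
      (cos_le_cos_of_mem_Icc_two_pi_sub (by linarith) ?_ ?_)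
    · have := abs_sub_abs_le_abs_sub z.arg (α * b); linarith
    · have := abs_sub z.arg (α * b); have := abs_arg_le_pi z; linarith
  have hφabs := abs_of_pos hφ0
  have hφabs' : |-φ| = φ := by rw [abs_neg, hφabs]
  obtain ⟨ρ, hρ⟩ : ∃ ρ : ℝ, ‖z‖ < Real.exp (α * ρ) :=
    ⟨Real.log (‖z‖ + 1) / α, by
      rw [mul_div_cancel₀ _ hα.ne', Real.exp_log (by positivity)]; linarith⟩
  have hdiff : ∀ w : ℂ, |w.im| ≤ φ → DifferentiableAt ℂ (mittagLefflerKernel α z) w := by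
    intro w hw
    unfold mittagLefflerKernel
    refine DifferentiableAt.mul (by fun_prop) (DifferentiableAt.inv (by fun_prop) ?_)
    rw [one_sub_mul_exp_neg]
    refine mul_ne_zero (exp_ne_zero _) (sub_ne_zero.2 fun h => ?_)
    have e1 : z.re = ‖z‖ * Real.cos (α * w.im) := by
      rw [← h, norm_exp, exp_re]; simp
    have e2 : Real.cos ψ < Real.cos (α * w.im) := by
      rw [← Real.cos_abs (α * w.im)]
      refine Real.cos_lt_cos_of_nonneg_of_le_pi (abs_nonneg _) hψ' ?_
      rw [abs_mul, abs_of_pos hα]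
      nlinarith
    nlinarith
  have key := hankelIntegral_eq_sub_of_tendsto (ρ := ρ)
    (M := fun x => Real.exp (Real.exp x) * (‖z‖ * Real.exp (-(α * x)) - 1)⁻¹) hφ0 hdiff
    (integrable_mittagLefflerKernel_line hα hcos hκ hz (hdist φ hφabs))
    (integrable_mittagLefflerKernel_line hα hcos' hκ hz (hdist (-φ) hφabs'))
    (by filter_upwards [eventually_norm_mittagLefflerKernel_le hα hz] with x hx y _ using hx y)
    (tendsto_exp_exp_mul_inv_atBot hα hz0)
  rw [hankelIntegral_mittagLefflerKernel h1 hφπ hα hρ] at key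
  have hn : 2 * Real.pi * ‖mittagLeffler α z‖ ≤ 2 * (lineMass α φ * (κ * ‖z‖)⁻¹) := by
    have e : ‖2 * Real.pi * I * mittagLeffler α z‖ = 2 * Real.pi * ‖mittagLeffler α z‖ := by
      simp [abs_of_pos hπ]
    rw [← e, key]
    refine (norm_sub_le _ _).trans ?_
    have i1 := norm_integral_mittagLefflerKernel_line_le hα hcos hκ hz (hdist φ hφabs)
    have i2 := norm_integral_mittagLefflerKernel_line_le hα hcos' hκ hz (hdist (-φ) hφabs')
    rw [lineMass_neg] at i2
    linarith
  have e : lineMass α φ * κ⁻¹ / ‖z‖ = lineMass α φ * (κ * ‖z‖)⁻¹ := by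
    rw [mul_inv]; ring
  rw [e]
  have : 0 ≤ ‖mittagLeffler α z‖ := norm_nonneg _
  nlinarith [Real.pi_gt_three]

end MittagLeffler

/-! ### Exponential asymptotics inside the sector -/

section MittagLeffler

open Complex Set

/-- The entire function `(1 - exp (-α (w - w₀))) / (w - w₀)`. -/
def expQuotient (α : ℝ) (w₀ : ℂ) : ℂ → ℂ :=
  dslope (fun w => -cexp (-α * (w - w₀))) w₀

variable {α : ℝ} {w₀ w : ℂ}

theorem expQuotient_of_ne (h : w ≠ w₀) :
    expQuotient α w₀ w = (w - w₀)⁻¹ * (1 - cexp (-α * (w - w₀))) := by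
  rw [expQuotient, dslope_of_ne _ h, slope_def_field]
  simp
  ring

theorem expQuotient_self : expQuotient α w₀ w₀ = α := by
  rw [expQuotient, dslope_same]
  have h : HasDerivAt (fun w : ℂ => -cexp (-α * (w - w₀))) (-(cexp (-α * (w₀ - w₀)) * (-α * 1))) w₀ :=
    ((((hasDerivAt_id w₀).sub_const w₀).const_mul (-α : ℂ)).cexp).neg
  rw [h.deriv]; simp

theorem differentiable_expQuotient : Differentiable ℂ (expQuotient α w₀) := by
  rw [← differentiableOn_univ]
  exact (differentiableOn_dslope univ_mem).2 (Differentiable.differentiableOn (by fun_prop))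

/-- A zero other than w₀ would require α(w - w₀) to be a nonzero multiple of 2πi, which the bound on
the imaginary parts excludes. -/
theorem expQuotient_ne_zero (hα : 0 < α) (h : α * |w.im - w₀.im| < 2 * Real.pi) :
    expQuotient α w₀ w ≠ 0 := by
  by_cases hw : w = w₀
  · rw [hw, expQuotient_self]; exact ofReal_ne_zero.2 hα.ne'
  rw [expQuotient_of_ne hw]
  refine mul_ne_zero (inv_ne_zero (sub_ne_zero.2 hw)) (sub_ne_zero.2 fun h1 => hw ?_)
  obtain ⟨n, hn⟩ := exp_eq_one_iff.1 h1.symm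
  have him := congrArg im hn
  simp only [neg_mul, neg_im, sub_im, mul_im, intCast_re, intCast_im, zero_mul, add_zero, mul_re,
    I_re, I_im, ofReal_re, ofReal_im, mul_zero, mul_one, sub_zero, re_ofNat, im_ofNat] at him
  have hn0 : n = 0 := by
    have h2 : |(n : ℝ)| * (2 * Real.pi) < 1 * (2 * Real.pi) := by
      have : |(n : ℝ) * (2 * Real.pi)| = α * |w.im - w₀.im| := by
        rw [← him, abs_neg, abs_mul, abs_of_pos hα]
      rw [abs_mul, abs_of_pos Real.two_pi_pos] at this
      linarith
    have h3 := lt_of_mul_lt_mul_right h2 Real.two_pi_pos.le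
    rw [← Int.cast_abs] at h3
    exact Int.abs_lt_one_iff.1 (by exact_mod_cast h3)
  rw [hn0] at hn
  have hα' : (α : ℂ) ≠ 0 := ofReal_ne_zero.2 hα.ne'
  simp only [Int.cast_zero, zero_mul, mul_eq_zero, neg_eq_zero, hα', false_or] at hn
  exact sub_eq_zero.1 hn

/-- The difference of the Mittag-Leffler kernels of orders `α` and `1` with a common pole `w₀`,
weighted such that the pole cancels. -/
def kernelDifference (α : ℝ) (w₀ w : ℂ) : ℂ :=
  cexp (cexp w) *
    dslope (fun w => (expQuotient α w₀ w)⁻¹ - (α : ℂ)⁻¹ * (expQuotient 1 w₀ w)⁻¹) w₀ w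

/-- Each denominator factors as (w - w₀) q_β(w), with q_β(w₀) = β for β = α and β = 1. The weight
α⁻¹ makes 1/q_α - α⁻¹/q_1 vanish at w₀, so its `dslope` is just division by w - w₀. -/
theorem kernelDifference_of_ne (hα : 0 < α) (h : w ≠ w₀) :
    kernelDifference α w₀ w = mittagLefflerKernel α (cexp (α * w₀)) w
      - (α : ℂ)⁻¹ * mittagLefflerKernel 1 (cexp w₀) w := by
  have hα' : (α : ℂ) ≠ 0 := ofReal_ne_zero.2 hα.ne'
  have e1 : cexp (α * w₀) * cexp (-α * w) = cexp (-α * (w - w₀)) := by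
    rw [← exp_add]; congr 1; ring
  have e2 : cexp w₀ * cexp (-(1 : ℝ) * w) = cexp (-(1 : ℝ) * (w - w₀)) := by
    rw [← exp_add]; congr 1; push_cast; ring
  rw [kernelDifference, dslope_of_ne _ h, slope_def_field, expQuotient_self, expQuotient_self,
    expQuotient_of_ne h, expQuotient_of_ne h, mittagLefflerKernel, mittagLefflerKernel, e1, e2]
  have : w - w₀ ≠ 0 := sub_ne_zero.2 h
  simp only [mul_inv, inv_inv, ofReal_one, inv_one, mul_one, sub_self, sub_zero]
  field_simp

theorem differentiableAt_kernelDifference (hα : 0 < α) (hα1 : α ≤ 1)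
    (hw₀ : |w₀.im| < Real.pi / 2) (hw : |w.im| < Real.pi) :
    DifferentiableAt ℂ (kernelDifference α w₀) w := by
  have hπ := Real.pi_pos
  set U : Set ℂ := {w | |w.im| < Real.pi}
  have hU : IsOpen U := isOpen_lt (by fun_prop) (by fun_prop)
  have hbound : ∀ v ∈ U, |v.im - w₀.im| < 2 * Real.pi := fun v hv => by
    have := abs_sub v.im w₀.im
    have : |v.im| < Real.pi := hv
    linarith
  have h1 : DifferentiableOn ℂ
      (fun w => (expQuotient α w₀ w)⁻¹ - (α : ℂ)⁻¹ * (expQuotient 1 w₀ w)⁻¹) U := by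
    refine DifferentiableOn.sub ?_ (DifferentiableOn.const_mul ?_ _)
    · refine DifferentiableOn.inv differentiable_expQuotient.differentiableOn fun v hv =>
        expQuotient_ne_zero hα ?_
      have := abs_nonneg (v.im - w₀.im)
      nlinarith [hbound v hv]
    · refine DifferentiableOn.inv differentiable_expQuotient.differentiableOn fun v hv =>
        expQuotient_ne_zero one_pos ?_
      simpa using hbound v hv
  have h2 := (differentiableOn_dslope (hU.mem_nhds (show |w₀.im| < Real.pi by linarith))).2 h1
  exact DifferentiableAt.mul (by fun_prop) (h2.differentiableAt (hU.mem_nhds hw))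

/-- The kernel difference is holomorphic in |im w| < π, so its contour integral reduces to two line
integrals. On them each kernel is bounded uniformly in a: the distance to the pole is at least κ_β
|e^{βw₀}| ≥ κ_β, because a ≥ 0. -/
theorem exists_norm_mittagLeffler_sub_exp_le (hα : 0 < α) (hα1 : α ≤ 1) {θ : ℝ}
    (hθ : |θ| < Real.pi / 2) :
    ∃ C : ℝ, ∀ a : ℝ, 0 ≤ a → ‖mittagLeffler α (cexp (α * (a + θ * I)))
      - (α : ℂ)⁻¹ * cexp (cexp (a + θ * I))‖ ≤ C := by
  have hπ := Real.pi_pos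
  set φ : ℝ := 3 / 4 * Real.pi with hφd
  have h1 : Real.pi / 2 < φ := by rw [hφd]; linarith
  have hφπ : φ < Real.pi := by rw [hφd]; linarith
  have hφ0 : 0 < φ := by linarith
  have hcos : Real.cos φ < 0 := Real.cos_neg_of_pi_div_two_lt_of_lt h1 (by linarith)
  have hcos' : Real.cos (-φ) < 0 := by rwa [Real.cos_neg]
  set κ : ℝ → ℝ := fun β => Real.sin (β * (φ - |θ|)) with hκd
  have hκ : ∀ β, 0 < β → β ≤ 1 → 0 < κ β := fun β hβ hβ1 => by
    have h0 := abs_nonneg θ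
    exact Real.sin_pos_of_pos_of_lt_pi (mul_pos hβ (by linarith)) (by nlinarith)
  have hφabs := abs_of_pos hφ0
  have hφabs' : |-φ| = φ := by rw [abs_neg, hφabs]
  set B : ℝ → ℝ := fun β => lineMass β φ * (κ β)⁻¹ with hBd
  refine ⟨2 * (B α + α⁻¹ * B 1), fun a ha => ?_⟩
  set w₀ : ℂ := a + θ * I with hw₀
  have hre : w₀.re = a := by simp [hw₀]
  have him : w₀.im = θ := by simp [hw₀]
  have hnorm : ∀ β : ℝ, ‖cexp (β * w₀)‖ = Real.exp (β * a) := fun β => by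
    rw [norm_exp, re_ofReal_mul, hre]
  have hnorm1 : ∀ β : ℝ, 0 < β → 1 ≤ ‖cexp (β * w₀)‖ := fun β hβ => by
    rw [hnorm]; exact Real.one_le_exp (by positivity)
  have hdist : ∀ β, 0 < β → β ≤ 1 → ∀ b : ℝ, |b| = φ → ∀ x : ℝ,
      κ β * ‖cexp (β * w₀)‖ ≤ ‖cexp (β * (x + b * I)) - cexp (β * w₀)‖ := by
    intro β hβ hβ1 b hb x
    rw [hnorm, exp_real_mul_line, hw₀, exp_real_mul_line]
    refine sin_mul_le_norm_ray_sub (Real.exp_pos _).le (Real.exp_pos _).le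
      (cos_le_cos_of_mem_Icc_two_pi_sub (mul_nonneg hβ.le (by linarith)) ?_ ?_)
    · rw [← mul_sub, abs_mul, abs_of_pos hβ]
      have := abs_sub_abs_le_abs_sub b θ
      rw [abs_sub_comm, hb] at this
      gcongr
    · rw [← mul_sub, abs_mul, abs_of_pos hβ]
      have := abs_sub θ b
      rw [hb] at this
      nlinarith
  have hint : ∀ β, 0 < β → β ≤ 1 → ∀ b : ℝ, |b| = φ → Real.cos b < 0 →
      Integrable fun x : ℝ => mittagLefflerKernel β (cexp (β * w₀)) (x + b * I) :=
    fun β hβ hβ1 b hb hc => integrable_mittagLefflerKernel_line hβ hc (hκ β hβ hβ1)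
      (exp_ne_zero _) (hdist β hβ hβ1 b hb)
  have hbd : ∀ β, 0 < β → β ≤ 1 → ∀ b : ℝ, |b| = φ → Real.cos b < 0 → lineMass β b = lineMass β φ →
      ‖∫ x : ℝ, mittagLefflerKernel β (cexp (β * w₀)) (x + b * I)‖ ≤ B β := by
    intro β hβ hβ1 b hb hc hbφ
    refine (norm_integral_mittagLefflerKernel_line_le hβ hc (hκ β hβ hβ1)
      (exp_ne_zero _) (hdist β hβ hβ1 b hb)).trans ?_
    rw [hbφ]
    have hκβ := hκ β hβ hβ1
    exact mul_le_mul_of_nonneg_left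
      (inv_anti₀ hκβ (le_mul_of_one_le_right hκβ.le (hnorm1 β hβ))) (lineMass_nonneg β φ)
  -- The vertical side at a + 1 lies to the right of the pole, whose real part is a.
  have hH : ∀ β, 0 < β → hankelIntegral φ (a + 1) (mittagLefflerKernel β (cexp (β * w₀)))
      = 2 * Real.pi * I * mittagLeffler β (cexp (β * w₀)) := fun β hβ =>
    hankelIntegral_mittagLefflerKernel h1 hφπ hβ (by
      rw [hnorm]; exact Real.exp_lt_exp.2 (by nlinarith))
  have hone : cexp (((1 : ℝ) : ℂ) * w₀) = cexp w₀ := by simp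
  have hne : ∀ b : ℝ, |b| = φ → ∀ x : ℝ, (x + b * I : ℂ) ≠ w₀ := fun b hb x h => by
    have := congrArg im h
    rw [him] at this
    simp at this
    rw [this] at hb
    linarith
  have hline : ∀ b : ℝ, |b| = φ → ∀ x : ℝ, kernelDifference α w₀ (x + b * I)
      = mittagLefflerKernel α (cexp (α * w₀)) (x + b * I)
        - (α : ℂ)⁻¹ * mittagLefflerKernel 1 (cexp (((1 : ℝ) : ℂ) * w₀)) (x + b * I) :=
    fun b hb x => by rw [kernelDifference_of_ne hα (hne b hb x), hone]
  have hintD : ∀ b : ℝ, |b| = φ → Real.cos b < 0 →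
      Integrable fun x : ℝ => kernelDifference α w₀ (x + b * I) := fun b hb hc => by
    simp only [hline b hb]
    exact (hint α hα hα1 b hb hc).sub ((hint 1 one_pos le_rfl b hb hc).const_mul _)
  have hbdD : ∀ b : ℝ, |b| = φ → Real.cos b < 0 → (∀ β, lineMass β b = lineMass β φ) →
      ‖∫ x : ℝ, kernelDifference α w₀ (x + b * I)‖ ≤ B α + α⁻¹ * B 1 := fun b hb hc hbφ => by
    simp only [hline b hb]
    rw [integral_sub (hint α hα hα1 b hb hc) ((hint 1 one_pos le_rfl b hb hc).const_mul _),
      integral_const_mul]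
    refine (norm_sub_le _ _).trans (add_le_add (hbd α hα hα1 b hb hc (hbφ α)) ?_)
    rw [norm_mul, norm_inv, norm_real, Real.norm_of_nonneg hα.le]
    gcongr
    exact hbd 1 one_pos le_rfl b hb hc (hbφ 1)
  have hcont : ∀ β : ℝ, 0 < β → ContinuousOn (mittagLefflerKernel β (cexp (β * w₀)))
      {w | w.re = a + 1 ∧ |w.im| ≤ φ} := by
    intro β hβ
    unfold mittagLefflerKernel
    refine ContinuousOn.mul (by fun_prop) (ContinuousOn.inv₀ (by fun_prop) fun w hw h => ?_)
    have h2 : ‖cexp (β * w₀) * cexp (-β * w)‖ = 1 := by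
      rw [← sub_eq_zero.1 h, norm_one]
    rw [norm_mul_exp_neg, hnorm, hw.1, ← Real.exp_add, Real.exp_eq_one_iff] at h2
    nlinarith
  have hHD : hankelIntegral φ (a + 1) (kernelDifference α w₀)
      = 2 * Real.pi * I * (mittagLeffler α (cexp (α * w₀)) - (α : ℂ)⁻¹ * cexp (cexp w₀)) := by
    rw [hankelIntegral_congr (g := fun w => mittagLefflerKernel α (cexp (α * w₀)) w
        - (α : ℂ)⁻¹ * mittagLefflerKernel 1 (cexp (((1 : ℝ) : ℂ) * w₀)) w) hφ0 fun w hw _ => ?_,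
      hankelIntegral_sub (hcont α hα) ((hcont 1 one_pos).const_mul _) hφ0
        (hint α hα hα1 φ hφabs hcos).integrableOn
        (hint α hα hα1 (-φ) hφabs' hcos').integrableOn
        ((hint 1 one_pos le_rfl φ hφabs hcos).const_mul _).integrableOn
        ((hint 1 one_pos le_rfl (-φ) hφabs' hcos').const_mul _).integrableOn,
      hankelIntegral_const_mul, hH α hα, hH 1 one_pos, hone, mittagLeffler_one]
    · ring
    · rw [hone]
      refine kernelDifference_of_ne hα fun h => ?_
      rw [h, hre] at hw
      linarith
  have key := hankelIntegral_eq_sub_of_tendsto (ρ := a + 1) (f := kernelDifference α w₀)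
    (M := fun x => Real.exp (Real.exp x) * (‖cexp (α * w₀)‖ * Real.exp (-(α * x)) - 1)⁻¹ + α⁻¹ *
      (Real.exp (Real.exp x) * (‖cexp (((1 : ℝ) : ℂ) * w₀)‖ * Real.exp (-(1 * x)) - 1)⁻¹)) hφ0
    (fun w hw => differentiableAt_kernelDifference hα hα1 (by rwa [him]) (hw.trans_lt hφπ))
    (hintD φ hφabs hcos) (hintD (-φ) hφabs' hcos') ?_ ?_
  · rw [hHD] at key
    have hn : 2 * Real.pi * ‖mittagLeffler α (cexp (α * w₀)) - (α : ℂ)⁻¹ * cexp (cexp w₀)‖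
        ≤ 2 * (B α + α⁻¹ * B 1) := by
      have e : ∀ v : ℂ, ‖2 * Real.pi * I * v‖ = 2 * Real.pi * ‖v‖ := fun v => by
        simp [abs_of_pos hπ]
      rw [← e, key]
      refine (norm_sub_le _ _).trans ?_
      linarith [hbdD φ hφabs hcos fun β => rfl, hbdD (-φ) hφabs' hcos' fun β => lineMass_neg β φ]
    have h0 := norm_nonneg (mittagLeffler α (cexp (α * w₀)) - (α : ℂ)⁻¹ * cexp (cexp w₀))
    nlinarith [Real.pi_gt_three]
  · filter_upwards [eventually_norm_mittagLefflerKernel_le hα (exp_ne_zero (α * w₀)),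
      eventually_norm_mittagLefflerKernel_le one_pos (exp_ne_zero (((1 : ℝ) : ℂ) * w₀)),
      eventually_lt_atBot a] with x hx1 hx2 hxa y _
    rw [kernelDifference_of_ne hα fun h => ?_]
    · refine (norm_sub_le _ _).trans (add_le_add (hx1 y) ?_)
      rw [norm_mul, norm_inv, norm_real, Real.norm_of_nonneg hα.le, ← hone]
      gcongr
      exact hx2 y
    · have := congrArg re h
      rw [hre] at this
      simp at this
      linarith
  · simpa using (tendsto_exp_exp_mul_inv_atBot hα (norm_pos_iff.2 (exp_ne_zero (α * w₀)))).add
      ((tendsto_exp_exp_mul_inv_atBot one_pos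
        (norm_pos_iff.2 (exp_ne_zero (((1 : ℝ) : ℂ) * w₀)))).const_mul α⁻¹)

end MittagLeffler

/-! ### The Vekua transform -/

section Vekua

open Complex Set

theorem integral_pow_mul_one_sub_pow (m n : ℕ) :
    ∫ t in (0 : ℝ)..1, (t : ℂ) ^ m * (1 - t : ℂ) ^ n
      = (m.factorial * n.factorial : ℂ) / (m + n + 1).factorial := by
  have h := betaIntegral_eq_Gamma_mul_div (m + 1) (n + 1) (by norm_cast; omega) (by norm_cast; omega)
  rw [betaIntegral, Gamma_nat_eq_factorial, Gamma_nat_eq_factorial,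
    show (m + 1 + (n + 1) : ℂ) = ((m + n + 1 : ℕ) : ℂ) + 1 by push_cast; ring,
    Gamma_nat_eq_factorial] at h
  simpa using h

/-- The coefficients of the entire function that defines the kernel of the Vekua transform. -/
def vekuaCoeff (n : ℕ) : ℂ := (-1) ^ (n + 1) / (n.factorial * (n + 1).factorial)

theorem norm_vekuaCoeff_le (n : ℕ) : ‖vekuaCoeff n‖ ≤ (n.factorial : ℝ)⁻¹ := by
  have h1 : (1 : ℝ) ≤ (n + 1).factorial := by exact_mod_cast (n + 1).factorial_pos
  have h0 : (0 : ℝ) < n.factorial := by exact_mod_cast n.factorial_pos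
  rw [vekuaCoeff, norm_div, norm_pow, norm_neg, norm_one, one_pow, norm_mul, norm_natCast,
    norm_natCast, one_div]
  exact inv_anti₀ h0 (le_mul_of_one_le_right h0.le h1)

theorem summable_vekuaCoeff {r : ℝ} (hr : 0 ≤ r) : Summable fun n => ‖vekuaCoeff n‖ * r ^ n := by
  refine (Real.summable_pow_div_factorial r).of_nonneg_of_le (fun n => by positivity) fun n => ?_
  rw [div_eq_inv_mul]
  gcongr
  exact norm_vekuaCoeff_le n

/-- The kernel of the Vekua transform, as a function of `c = (k|x|/2)²` and `t`. It is
`-d/dt J₀(k|x|√(1-t))`. -/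
def vekuaKernel (c t : ℝ) : ℂ := c * ∑' n, vekuaCoeff n * (c * (1 - t) : ℂ) ^ n

theorem contDiff_vekuaKernel {n : WithTop ℕ∞} : ContDiff ℝ n fun p : ℝ × ℝ => vekuaKernel p.1 p.2 := by
  have h : ContDiff ℝ n fun z : ℂ => ∑' n, vekuaCoeff n * z ^ n :=
    ((differentiable_tsum_mul_pow fun r hr => summable_vekuaCoeff hr).contDiff (n := n)).restrict_scalars ℝ
  have h1 : ContDiff ℝ n fun p : ℝ × ℝ => (p.1 : ℂ) := ofRealCLM.contDiff.comp contDiff_fst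
  have h2 : ContDiff ℝ n fun p : ℝ × ℝ => (p.2 : ℂ) := ofRealCLM.contDiff.comp contDiff_snd
  exact h1.mul (h.comp (h1.mul (contDiff_const.sub h2)))

/-- Termwise Beta integrals: the factor (1-t)^n produces the term of index n + 1 in the Bessel
series. -/
theorem integral_pow_mul_vekuaKernel (m : ℕ) (c : ℝ) :
    HasSum (fun n => (m.factorial : ℂ) * (-1) ^ (n + 1)
        / ((m + (n + 1)).factorial * (n + 1).factorial) * (c : ℂ) ^ (n + 1))
      (∫ t in (0 : ℝ)..1, (t : ℂ) ^ m * vekuaKernel c t) := by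
  have h := intervalIntegral.hasSum_integral_of_dominated_convergence (μ := volume)
    (a := 0) (b := 1)
    (F := fun n (t : ℝ) => (t : ℂ) ^ m * (c * (vekuaCoeff n * (c * (1 - t) : ℂ) ^ n)))
    (f := fun t => (t : ℂ) ^ m * vekuaKernel c t)
    (fun n _ => |c| * (‖vekuaCoeff n‖ * |c| ^ n)) (fun n => by fun_prop) ?_ ?_ ?_ ?_
  · refine Eq.mp (congrArg (HasSum · _) (funext fun n => ?_)) h
    have e : ∀ t : ℝ, (t : ℂ) ^ m * (c * (vekuaCoeff n * (c * (1 - t) : ℂ) ^ n))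
        = (c ^ (n + 1) * vekuaCoeff n) * ((t : ℂ) ^ m * (1 - t : ℂ) ^ n) := fun t => by
      rw [mul_pow]; ring
    simp only [e]
    rw [intervalIntegral.integral_const_mul, integral_pow_mul_one_sub_pow, vekuaCoeff]
    have h1 : (n.factorial : ℂ) ≠ 0 := by exact_mod_cast n.factorial_ne_zero
    have h2 : ((n + 1).factorial : ℂ) ≠ 0 := by exact_mod_cast (n + 1).factorial_ne_zero
    have h3 : ((m + n + 1).factorial : ℂ) ≠ 0 := by exact_mod_cast (m + n + 1).factorial_ne_zero
    rw [← add_assoc]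
    field_simp
  · intro n
    refine ae_of_all _ fun t ht => ?_
    rw [uIoc_of_le zero_le_one] at ht
    have h1 : ‖(1 - t : ℂ)‖ ≤ 1 := by
      rw [← ofReal_one, ← ofReal_sub, norm_real, Real.norm_eq_abs, abs_le]
      constructor <;> linarith [ht.1, ht.2]
    have h2 : |t| ≤ 1 := by
      rw [abs_le]
      constructor <;> linarith [ht.1, ht.2]
    rw [norm_mul, norm_mul, norm_mul, norm_pow, norm_pow, norm_mul, norm_real, Real.norm_eq_abs]
    calc _ ≤ 1 * (|c| * (‖vekuaCoeff n‖ * (|c| * 1) ^ n)) := by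
          gcongr
          · exact pow_le_one₀ (abs_nonneg _) h2
          · rw [norm_real, Real.norm_eq_abs]
          · rw [norm_real, Real.norm_eq_abs]
      _ = _ := by ring
  · exact ae_of_all _ fun t _ => (summable_vekuaCoeff (abs_nonneg c)).mul_left _
  · exact intervalIntegrable_const
  · refine ae_of_all _ fun t _ => HasSum.mul_left _ (HasSum.mul_left _ (Summable.hasSum ?_))
    refine Summable.of_norm ((summable_vekuaCoeff (norm_nonneg (c * (1 - t) : ℂ))).congr fun n => ?_)
    rw [norm_mul (vekuaCoeff n), norm_pow]

/-- The summand 1 is the leading term of the normalized Bessel series. On the right, m occurs only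
in s^m, which is what allows the sum over m to be taken inside the integral. -/
theorem besselJhat_eq_one_add_integral (m : ℕ) (t : ℝ) :
    (besselJhat m t : ℂ) = 1 + ∫ s in (0 : ℝ)..1, (s : ℂ) ^ m * vekuaKernel ((t / 2) ^ 2) s := by
  by_cases ht : t = 0
  · simp [besselJhat, ht, vekuaKernel]
  have h := integral_pow_mul_vekuaKernel m ((t / 2) ^ 2)
  rw [← h.tsum_eq, besselJhat, if_neg ht, besselJ]
  have e1 : (2 / t) ^ m * (t / 2) ^ m = 1 := by
    rw [← mul_pow]; field_simp; simp
  rw [mul_mul_mul_comm, ← mul_assoc, e1, one_mul]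
  have hm : (m.factorial : ℂ) ≠ 0 := by exact_mod_cast m.factorial_ne_zero
  have h0 : HasSum (fun n : ℕ => (m.factorial : ℂ) * (-1) ^ n
      / ((m + n).factorial * n.factorial) * (((t / 2) ^ 2 : ℝ) : ℂ) ^ n)
      (1 + ∑' n : ℕ, (m.factorial : ℂ) * (-1) ^ (n + 1)
        / ((m + (n + 1)).factorial * (n + 1).factorial) * (((t / 2) ^ 2 : ℝ) : ℂ) ^ (n + 1)) := by
    have := (hasSum_nat_add_iff (f := fun n : ℕ => (m.factorial : ℂ) * (-1) ^ n
      / ((m + n).factorial * n.factorial) * (((t / 2) ^ 2 : ℝ) : ℂ) ^ n) 1).1 h.summable.hasSum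
    simpa [add_comm, div_self hm] using this
  rw [← h0.tsum_eq]
  push_cast
  rw [← tsum_mul_left]
  refine tsum_congr fun n => ?_
  rw [pow_mul]; ring

theorem modifiedML_eq (k : ℝ) {α : ℝ} (hα : 0 < α) (τ : ℝ) (x : Plane) :
    modifiedML k α τ x = mittagLeffler α (τ * (x 0 + I * x 1))
      + ∫ t in (0 : ℝ)..1, mittagLeffler α (t * (τ * (x 0 + I * x 1)))
        * vekuaKernel ((k * ‖x‖ / 2) ^ 2) t := by
  set z : ℂ := τ * (x 0 + I * x 1) with hz
  set c : ℝ := (k * ‖x‖ / 2) ^ 2 with hc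
  have hK : Continuous fun t : ℝ => vekuaKernel c t :=
    (contDiff_vekuaKernel (n := 0)).continuous.comp (by fun_prop : Continuous fun t : ℝ => (c, t))
  have hF : ∀ m : ℕ, Continuous fun t : ℝ =>
      (t * z : ℂ) ^ m / (Real.Gamma (α * m + 1) : ℂ) * vekuaKernel c t := fun m =>
    (((by fun_prop : Continuous fun t : ℝ => (t * z : ℂ)).pow m).div_const _).mul hK
  have h := intervalIntegral.hasSum_integral_of_dominated_convergence (μ := volume)
    (a := 0) (b := 1)
    (F := fun (m : ℕ) (t : ℝ) => (t * z : ℂ) ^ m / (Real.Gamma (α * m + 1) : ℂ) * vekuaKernel c t)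
    (f := fun t => mittagLeffler α (t * z) * vekuaKernel c t)
    (fun m t => ‖z ^ m / (Real.Gamma (α * m + 1) : ℂ)‖ * ‖vekuaKernel c t‖)
    (fun m => (hF m).aestronglyMeasurable) ?_ ?_ ?_ ?_
  · have h1 := (summable_mittagLeffler hα z).hasSum.add h
    rw [mittagLeffler, ← h1.tsum_eq, modifiedML]
    refine tsum_congr fun m => ?_
    rw [besselJhat_eq_one_add_integral, ← hz, ← hc, mul_add, mul_one, ← intervalIntegral.integral_const_mul]
    congr 2
    ext t
    rw [mul_pow (t : ℂ), hz]; ring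
  · intro m
    refine ae_of_all _ fun t ht => ?_
    rw [uIoc_of_le zero_le_one] at ht
    rw [norm_mul, norm_div, norm_div, norm_pow, norm_pow, norm_mul, norm_real, Real.norm_eq_abs,
      abs_of_pos ht.1]
    gcongr
    · exact mul_nonneg ht.1.le (norm_nonneg _)
    · exact mul_le_of_le_one_left (norm_nonneg _) ht.2
  · exact ae_of_all _ fun t _ => (summable_mittagLeffler hα z).norm.mul_right _
  · refine Continuous.intervalIntegrable ?_ _ _
    simp only [tsum_mul_right]
    fun_prop
  · exact ae_of_all _ fun t _ => (summable_mittagLeffler hα _).hasSum.mul_right _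

end Vekua

/-! ### Regularity in the plane variable -/

section Smoothness

open Complex Set

/-- A `C¹` integrand can be differentiated under the integral over a compact interval. -/
theorem hasFDerivAt_intervalIntegral_of_contDiff {H : Type*} [NormedAddCommGroup H]
    [NormedSpace ℝ H] [FiniteDimensional ℝ H] {Ψ : H × ℝ → ℂ} (hΨ : ContDiff ℝ 1 Ψ) (x : H) :
    HasFDerivAt (fun x => ∫ t in (0 : ℝ)..1, Ψ (x, t))
      (∫ t in (0 : ℝ)..1, (fderiv ℝ Ψ (x, t)).comp (ContinuousLinearMap.inl ℝ H ℝ)) x := by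
  have hc : Continuous fun p : H × ℝ => (fderiv ℝ Ψ p).comp (ContinuousLinearMap.inl ℝ H ℝ) :=
    (hΨ.continuous_fderiv one_ne_zero).clm_comp continuous_const
  obtain ⟨M, hM⟩ := ((isCompact_closedBall x 1).prod
    (isCompact_Icc (a := (0 : ℝ)) (b := 1))).bddAbove_image hc.norm.continuousOn
  refine intervalIntegral.hasFDerivAt_integral_of_dominated_of_fderiv_le
    (F := fun x t => Ψ (x, t))
    (F' := fun x t => (fderiv ℝ Ψ (x, t)).comp (ContinuousLinearMap.inl ℝ H ℝ))
    (bound := fun _ => M) (Metric.closedBall_mem_nhds x one_pos) ?_ ?_ ?_ ?_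
    intervalIntegrable_const ?_
  · exact Eventually.of_forall fun y =>
      (hΨ.continuous.comp (by fun_prop : Continuous fun t : ℝ => (y, t))).aestronglyMeasurable
  · exact (hΨ.continuous.comp (by fun_prop : Continuous fun t : ℝ => (x, t))).intervalIntegrable _ _
  · exact (hc.comp (by fun_prop : Continuous fun t : ℝ => (x, t))).aestronglyMeasurable
  · refine ae_of_all _ fun t ht y hy => hM (mem_image_of_mem _ ⟨hy, ?_⟩)
    rw [uIoc_of_le zero_le_one] at ht
    exact Ioc_subset_Icc_self ht
  · refine ae_of_all _ fun t _ y _ => ?_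
    exact ((hΨ.differentiable one_ne_zero) (y, t)).hasFDerivAt.comp y
      ((hasFDerivAt_id y).prodMk (hasFDerivAt_const t y))

theorem contDiff_one_intervalIntegral {H : Type*} [NormedAddCommGroup H]
    [NormedSpace ℝ H] [FiniteDimensional ℝ H] {Ψ : H × ℝ → ℂ} (hΨ : ContDiff ℝ 1 Ψ) :
    ContDiff ℝ 1 fun x => ∫ t in (0 : ℝ)..1, Ψ (x, t) := by
  have h := hasFDerivAt_intervalIntegral_of_contDiff hΨ
  rw [contDiff_one_iff_fderiv]
  refine ⟨fun x => (h x).differentiableAt, ?_⟩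
  rw [funext fun x => (h x).fderiv]
  refine intervalIntegral.continuous_parametric_intervalIntegral_of_continuous' ?_ 0 1
  exact (hΨ.continuous_fderiv one_ne_zero).clm_comp continuous_const

/-- The identification of the plane with `ℂ`. -/
def planeToComplex : Plane →L[ℝ] ℂ :=
  ofRealCLM.comp (EuclideanSpace.proj 0) + I • ofRealCLM.comp (EuclideanSpace.proj 1)

theorem planeToComplex_apply (x : Plane) : planeToComplex x = x 0 + I * x 1 := by
  simp [planeToComplex]

theorem norm_planeToComplex (x : Plane) : ‖planeToComplex x‖ = ‖x‖ := by
  rw [planeToComplex_apply, mul_comm, norm_add_mul_I, EuclideanSpace.norm_eq]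
  simp

theorem re_planeToComplex (x : Plane) : (planeToComplex x).re = x 0 := by
  simp [planeToComplex_apply]

variable {k α τ : ℝ}

/-- The kernel of the Vekua transform as a function on the plane. -/
def planeKernel (k : ℝ) (p : Plane × ℝ) : ℂ := vekuaKernel ((k * ‖p.1‖ / 2) ^ 2) p.2

/-- The integrand in the Vekua transform of `E_α(τ ·)`. -/
def vekuaIntegrand (k α τ : ℝ) (p : Plane × ℝ) : ℂ :=
  mittagLeffler α (p.2 * (τ * planeToComplex p.1)) * planeKernel k p

/-- Only the square of the norm enters, so there is no singularity at the origin. -/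
theorem contDiff_planeKernel {n : WithTop ℕ∞} : ContDiff ℝ n (planeKernel k) := by
  have h : ContDiff ℝ n fun p : Plane × ℝ => (k * ‖p.1‖ / 2) ^ 2 := by
    have : ContDiff ℝ n fun p : Plane × ℝ => k ^ 2 / 4 * ‖p.1‖ ^ 2 :=
      contDiff_const.mul (contDiff_fst.norm_sq ℝ)
    convert this using 2
    ring
  exact contDiff_vekuaKernel.comp (h.prodMk contDiff_snd)

theorem contDiff_mittagLeffler_smul (hα : 0 < α) {n : WithTop ℕ∞} :
    ContDiff ℝ n fun p : Plane × ℝ => mittagLeffler α (p.2 * (τ * planeToComplex p.1)) := by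
  have h1 : ContDiff ℝ n (mittagLeffler α) :=
    ((differentiable_mittagLeffler hα).contDiff).restrict_scalars ℝ
  refine h1.comp ((ofRealCLM.contDiff.comp contDiff_snd).mul (contDiff_const.mul ?_))
  exact planeToComplex.contDiff.comp contDiff_fst

theorem contDiff_vekuaIntegrand (hα : 0 < α) {n : WithTop ℕ∞} :
    ContDiff ℝ n (vekuaIntegrand k α τ) :=
  (contDiff_mittagLeffler_smul hα).mul contDiff_planeKernel

theorem modifiedML_eq_add_integral (hα : 0 < α) : modifiedML k α τ = fun x =>
    mittagLeffler α (τ * planeToComplex x) + ∫ t in (0 : ℝ)..1, vekuaIntegrand k α τ (x, t) := by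
  funext x
  rw [modifiedML_eq k hα τ x]
  simp only [vekuaIntegrand, planeKernel, planeToComplex_apply]

theorem contDiff_modifiedML (hα : 0 < α) : ContDiff ℝ 1 (modifiedML k α τ) := by
  rw [modifiedML_eq_add_integral hα]
  refine ContDiff.add ?_ (contDiff_one_intervalIntegral (contDiff_vekuaIntegrand hα))
  have h1 : ContDiff ℝ 1 (mittagLeffler α) :=
    ((differentiable_mittagLeffler hα).contDiff).restrict_scalars ℝ
  exact h1.comp (contDiff_const.mul planeToComplex.contDiff)

end Smoothness

/-! ### Growth inside the cone and blow-up on curves -/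

section Growth

open Complex Set

variable {k α : ℝ}

/-- For r ≥ 1 the logarithmic estimate applies with a = log r / α ≥ 0; for r ≤ 1 both terms are
bounded by compactness. -/
theorem exists_norm_mittagLeffler_ray_sub_exp_le (hα : 0 < α) (hα1 : α ≤ 1) {θ : ℝ}
    (hθ : |θ| < Real.pi / 2) :
    ∃ C : ℝ, 0 ≤ C ∧ ∀ r : ℝ, 0 < r → ‖mittagLeffler α (r * cexp ((α * θ : ℝ) * I))
      - (α : ℂ)⁻¹ * cexp ((r ^ α⁻¹ : ℝ) * cexp (θ * I))‖ ≤ C := by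
  obtain ⟨C, hC⟩ := exists_norm_mittagLeffler_sub_exp_le hα hα1 hθ
  obtain ⟨C₀, hC₀⟩ := (isCompact_closedBall (0 : ℂ) 1).exists_bound_of_continuousOn
    (differentiable_mittagLeffler hα).continuous.continuousOn
  have hC0 : 0 ≤ C := (norm_nonneg _).trans (hC 0 le_rfl)
  have hC₀0 : 0 ≤ C₀ := (norm_nonneg _).trans (hC₀ 0 (by simp))
  refine ⟨C + (C₀ + α⁻¹ * Real.exp 1), by positivity, fun r hr => ?_⟩
  rcases le_total 1 r with h | h
  · have h1 := hC (Real.log r / α) (div_nonneg (Real.log_nonneg h) hα.le)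
    have e1 : cexp (α * ((Real.log r / α : ℝ) + θ * I)) = r * cexp ((α * θ : ℝ) * I) := by
      rw [exp_real_mul_line, mul_div_cancel₀ _ hα.ne', Real.exp_log hr]
    have e2 : cexp ((Real.log r / α : ℝ) + θ * I) = (r ^ α⁻¹ : ℝ) * cexp (θ * I) := by
      rw [exp_add, ← ofReal_exp, Real.rpow_def_of_pos hr, div_eq_mul_inv]
    rw [e1, e2] at h1
    have : 0 ≤ C₀ + α⁻¹ * Real.exp 1 := by positivity
    linarith
  · have h1 : ‖mittagLeffler α (r * cexp ((α * θ : ℝ) * I))‖ ≤ C₀ := by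
      refine hC₀ _ ?_
      rw [mem_closedBall_zero_iff, norm_mul, norm_exp_ofReal_mul_I, norm_real,
        Real.norm_of_nonneg hr.le, mul_one]
      exact h
    have h2 : ‖(α : ℂ)⁻¹ * cexp ((r ^ α⁻¹ : ℝ) * cexp (θ * I))‖ ≤ α⁻¹ * Real.exp 1 := by
      rw [norm_mul, norm_inv, norm_real, Real.norm_of_nonneg hα.le]
      gcongr
      refine (norm_exp_le_exp_norm _).trans (Real.exp_le_exp.2 ?_)
      rw [norm_mul, norm_exp_ofReal_mul_I, norm_real, mul_one,
        Real.norm_of_nonneg (Real.rpow_nonneg hr.le _)]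
      exact Real.rpow_le_one hr.le h (by positivity)
    exact ((norm_sub_le _ _).trans (add_le_add h1 h2)).trans (by linarith)

theorem norm_exp_mul_exp_mul_I (S θ : ℝ) :
    ‖cexp (S * cexp (θ * I))‖ = Real.exp (S * Real.cos θ) := by
  rw [norm_exp, re_ofReal_mul, exp_ofReal_mul_I_re]

theorem mem_axisCone {θ : ℝ} {x : Plane} : x ∈ axisCone θ ↔ ‖x‖ * Real.cos θ < x 0 := by
  simp [axisCone, openCone, EuclideanSpace.inner_single_right]

theorem isOpen_axisCone (θ : ℝ) : IsOpen (axisCone θ) := by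
  have : axisCone θ = {x | ‖x‖ * Real.cos θ < x 0} := by ext x; exact mem_axisCone
  rw [this]
  exact isOpen_lt (by fun_prop) (by fun_prop)

/-- With S = (τ|z|)^{1/α} cos θ, the main term is at least α⁻¹e^S - C, while integrating e^{St} over
[0, 1] gains a factor 1/S. The transform cannot cancel the main term once S is large. -/
theorem tendsto_norm_modifiedML_atTop (hα : 0 < α) (hα1 : α ≤ 1) {x : Plane}
    (hx : x ∈ axisCone (Real.pi * α / 2)) :
    Tendsto (fun τ => ‖modifiedML k α τ x‖) atTop atTop := by
  have hπ := Real.pi_pos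
  rw [mem_axisCone] at hx
  set z := planeToComplex x with hz
  rw [← norm_planeToComplex, ← re_planeToComplex, ← hz] at hx
  have hz0 : z ≠ 0 := by rintro h; simp [h] at hx
  have hR : 0 < ‖z‖ := norm_pos_iff.2 hz0
  set θ : ℝ := z.arg / α with hθd
  have hαθ : α * θ = z.arg := by rw [hθd]; field_simp
  have hθ : |θ| < Real.pi / 2 := by
    rw [← norm_mul_cos_arg z, mul_lt_mul_iff_right₀ hR, ← Real.cos_abs z.arg] at hx
    have h1 : |z.arg| < Real.pi * α / 2 := by
      by_contra! h
      exact absurd (Real.cos_le_cos_of_nonneg_of_le_pi (by positivity) (abs_arg_le_pi z) h)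
        (not_le.2 hx)
    rw [hθd, abs_div, abs_of_pos hα, div_lt_iff₀ hα]
    linarith
  have hσ : 0 < Real.cos θ := Real.cos_pos_of_mem_Ioo (abs_lt.1 hθ)
  set σ := Real.cos θ
  obtain ⟨C, hC0, hC⟩ := exists_norm_mittagLeffler_ray_sub_exp_le hα hα1 hθ
  obtain ⟨M, hM⟩ := (isCompact_Icc (a := (0 : ℝ)) (b := 1)).exists_bound_of_continuousOn
    (f := fun t => planeKernel k (x, t))
    ((contDiff_planeKernel (n := 0)).continuous.comp
      (by fun_prop : Continuous fun t : ℝ => (x, t))).continuousOn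
  have hM0 : 0 ≤ M := (norm_nonneg _).trans (hM 0 (by simp))
  set S : ℝ → ℝ := fun τ => (τ * ‖z‖) ^ α⁻¹ * σ with hS
  have hpolar : ∀ r : ℝ, (r * z : ℂ) = (r * ‖z‖ : ℝ) * cexp ((α * θ : ℝ) * I) := fun r => by
    rw [hαθ]; push_cast; rw [mul_assoc, norm_mul_exp_arg_mul_I]
  have hα' : ‖(α : ℂ)⁻¹‖ = α⁻¹ := by rw [norm_inv, norm_real, Real.norm_of_nonneg hα.le]
  have hlow : ∀ τ : ℝ, 0 < τ → α⁻¹ * Real.exp (S τ) - C ≤ ‖mittagLeffler α (τ * z)‖ := fun τ hτ => by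
    have h1 := hC (τ * ‖z‖) (by positivity)
    rw [← hpolar] at h1
    have h2 := norm_sub_norm_le ((α : ℂ)⁻¹ * cexp (((τ * ‖z‖) ^ α⁻¹ : ℝ) * cexp (θ * I)))
      (mittagLeffler α (τ * z))
    rw [norm_mul, norm_exp_mul_exp_mul_I, hα', norm_sub_rev] at h2
    simp only [hS]
    linarith
  have hup : ∀ τ : ℝ, 0 < τ → ∀ t ∈ Ioc (0 : ℝ) 1,
      ‖mittagLeffler α (t * (τ * z))‖ ≤ α⁻¹ * Real.exp (S τ * t) + C := fun τ hτ t ht => by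
    have h1 := hC (t * τ * ‖z‖) (by have := ht.1; positivity)
    rw [← hpolar, ofReal_mul, mul_assoc (t : ℂ)] at h1
    have h2 := norm_sub_norm_le (mittagLeffler α (t * (τ * z)))
      ((α : ℂ)⁻¹ * cexp (((t * τ * ‖z‖) ^ α⁻¹ : ℝ) * cexp (θ * I)))
    rw [norm_mul, norm_exp_mul_exp_mul_I, hα'] at h2
    have h3 : (t * τ * ‖z‖) ^ α⁻¹ * σ ≤ S τ * t := by
      -- This is where α ≤ 1 makes the exponent at most linear in t, so that the bound integrates
      -- explicitly.
      have h4 : t ^ α⁻¹ ≤ t := by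
        simpa using Real.rpow_le_rpow_of_exponent_ge ht.1 ht.2 ((one_le_inv₀ hα).2 hα1)
      rw [mul_assoc t, Real.mul_rpow ht.1.le (by positivity), hS]
      have : 0 ≤ (τ * ‖z‖) ^ α⁻¹ * σ := by positivity
      nlinarith
    have h5 : α⁻¹ * Real.exp ((t * τ * ‖z‖) ^ α⁻¹ * σ) ≤ α⁻¹ * Real.exp (S τ * t) := by gcongr
    linarith
  have hint : ∀ τ, 0 < τ → ‖∫ t in (0 : ℝ)..1, vekuaIntegrand k α τ (x, t)‖
      ≤ α⁻¹ * M * Real.exp (S τ) / S τ + C * M := fun τ hτ => by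
    have hSτ : 0 < S τ := by positivity
    have h1 : ‖∫ t in (0 : ℝ)..1, vekuaIntegrand k α τ (x, t)‖
        ≤ ∫ t in (0 : ℝ)..1, (α⁻¹ * Real.exp (S τ * t) + C) * M := by
      refine intervalIntegral.norm_integral_le_of_norm_le zero_le_one
        (ae_of_all _ fun t ht => ?_) (Continuous.intervalIntegrable (by fun_prop) _ _)
      rw [vekuaIntegrand, norm_mul]
      exact mul_le_mul (hup τ hτ t ht) (hM t (Ioc_subset_Icc_self ht)) (norm_nonneg _)
        (by positivity)
    have h2 : ∫ t in (0 : ℝ)..1, (α⁻¹ * Real.exp (S τ * t) + C) * M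
        = (α⁻¹ * ((Real.exp (S τ) - 1) / S τ) + C) * M := by
      rw [intervalIntegral.integral_mul_const, intervalIntegral.integral_add
        (Continuous.intervalIntegrable (by fun_prop) _ _) intervalIntegrable_const,
        intervalIntegral.integral_const_mul, intervalIntegral.integral_comp_mul_left _ hSτ.ne',
        integral_exp]
      simp [div_eq_inv_mul]
    rw [h2] at h1
    refine h1.trans ?_
    have h3 : (Real.exp (S τ) - 1) / S τ ≤ Real.exp (S τ) / S τ := by gcongr; linarith
    calc _ ≤ (α⁻¹ * (Real.exp (S τ) / S τ) + C) * M := by gcongr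
      _ = _ := by ring
  have hStop : Tendsto S atTop atTop :=
    (((tendsto_rpow_atTop (inv_pos.2 hα)).comp
      (tendsto_id.atTop_mul_const hR)).atTop_mul_const hσ)
  have hfin : Tendsto (fun τ => α⁻¹ / 2 * Real.exp (S τ) - C * (1 + M)) atTop atTop :=
    tendsto_atTop_add_const_right _ _ (Tendsto.const_mul_atTop (by positivity)
      (Real.tendsto_exp_atTop.comp hStop))
  refine tendsto_atTop_mono' _ ?_ hfin
  -- S ≥ 2M lets the integral's exponential part be absorbed by half of the main term.
  filter_upwards [eventually_gt_atTop 0, hStop.eventually_ge_atTop (2 * M)] with τ hτ hSM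
  have hSτ : 0 < S τ := by positivity
  have h1 := hlow τ hτ
  have h2 := hint τ hτ
  have h3 : α⁻¹ * M * Real.exp (S τ) / S τ ≤ α⁻¹ / 2 * Real.exp (S τ) := by
    rw [div_le_iff₀ hSτ]
    have : 0 ≤ α⁻¹ * Real.exp (S τ) := by positivity
    nlinarith
  rw [modifiedML_eq_add_integral hα]
  have h4 := norm_sub_norm_le (mittagLeffler α (τ * planeToComplex x))
    (-∫ t in (0 : ℝ)..1, vekuaIntegrand k α τ (x, t))
  rw [sub_neg_eq_add, norm_neg] at h4
  linarith

/-- Nonvanishing velocity prevents the curve from being constant. The 1-Lipschitz distance to one of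
its points maps the connected trace onto a set containing a nondegenerate interval, and Lipschitz
maps do not create length. -/
theorem IsRegularC2Curve.hausdorffMeasure_ne_zero {c : Set Plane} (hc : IsRegularC2Curve c) :
    (Measure.hausdorffMeasure 1 : Measure Plane) c ≠ 0 := by
  obtain ⟨I, γ, hI, ⟨t₀, ht₀⟩, hγ, hγ', rfl⟩ := hc
  have ht₀I := interior_subset ht₀
  obtain ⟨b, hb, hne⟩ : ∃ b ∈ I, γ b ≠ γ t₀ := by
    by_contra! h
    refine hγ' t₀ ht₀I ?_
    rw [derivWithin_congr (f := fun _ => γ t₀) h rfl]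
    simp
  set g : Plane → ℝ := fun y => dist y (γ t₀) with hg
  have hgL : LipschitzWith 1 g := LipschitzWith.dist_left _
  have hsub : Icc 0 (dist (γ b) (γ t₀)) ⊆ g '' (γ '' I) := by
    have hpre := (hI.isPreconnected.image γ hγ.continuousOn).image g hgL.continuous.continuousOn
    refine hpre.ordConnected.out ⟨γ t₀, mem_image_of_mem _ ht₀I, by simp [hg]⟩
      ⟨γ b, mem_image_of_mem _ hb, rfl⟩
  intro h0
  have h1 := hgL.hausdorffMeasure_image_le zero_le_one (γ '' I)
  rw [h0, mul_zero, hausdorffMeasure_real] at h1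
  have h2 := (measure_mono hsub).trans h1
  rw [Real.volume_Icc, sub_zero, nonpos_iff_eq_zero, ENNReal.ofReal_eq_zero] at h2
  exact absurd h2 (not_le.2 (dist_pos.2 hne))

/-- Pointwise divergence and Fatou's lemma suffice, since c has nonzero length; no uniformity along
the curve is needed. -/
theorem tendsto_curveL2Norm_modifiedML (hα : 0 < α) (hα1 : α ≤ 1) {c : Set Plane}
    (hc : IsRegularC2Curve c) (hsub : c ⊆ axisCone (Real.pi * α / 2)) :
    Tendsto (fun τ : ℝ => curveL2Norm c (modifiedML k α τ)) atTop (𝓝 ∞) := by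
  set μ := (Measure.hausdorffMeasure 1 : Measure Plane).restrict c with hμ
  have hμ0 : μ univ ≠ 0 := by
    rw [hμ, Measure.restrict_apply_univ]; exact hc.hausdorffMeasure_ne_zero
  have hmem : ∀ᵐ x ∂μ, x ∈ axisCone (Real.pi * α / 2) := by
    rw [ae_iff, hμ]
    have hm : MeasurableSet {x | x ∉ axisCone (Real.pi * α / 2)} :=
      (isOpen_axisCone _).measurableSet.compl
    rw [Measure.restrict_apply hm]
    refine measure_mono_null (t := ∅) (fun x hx => hx.1 (hsub hx.2)) (by simp)
  have hpt : ∀ᵐ x ∂μ, liminf (fun τ : ℝ => ‖modifiedML k α τ x‖ₑ ^ (2 : ℝ)) atTop = ∞ := by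
    filter_upwards [hmem] with x hx
    have h1 : Tendsto (fun τ : ℝ => ‖modifiedML k α τ x‖ₑ) atTop (𝓝 ∞) := by
      simp only [← ofReal_norm]
      exact ENNReal.tendsto_ofReal_atTop.comp (tendsto_norm_modifiedML_atTop hα hα1 hx)
    have h2 := (ENNReal.continuous_rpow_const (y := 2)).tendsto ∞ |>.comp h1
    rw [ENNReal.top_rpow_of_pos two_pos] at h2
    exact h2.liminf_eq
  have hfatou := lintegral_liminf_le (μ := μ) (u := (atTop : Filter ℝ))
    (f := fun (τ : ℝ) x => ‖modifiedML k α τ x‖ₑ ^ (2 : ℝ))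
    fun τ => ((contDiff_modifiedML hα).continuous.enorm.measurable).pow_const _
  rw [lintegral_congr_ae hpt, lintegral_const, ENNReal.top_mul hμ0] at hfatou
  have hlim : Tendsto (fun τ : ℝ => ∫⁻ x, ‖modifiedML k α τ x‖ₑ ^ (2 : ℝ) ∂μ) atTop (𝓝 ∞) :=
    tendsto_of_le_liminf_of_limsup_le hfatou le_top
  have h := (ENNReal.continuous_rpow_const (y := 1 / 2)).tendsto ∞ |>.comp hlim
  rw [ENNReal.top_rpow_of_pos (by norm_num)] at h
  refine h.congr fun τ => ?_
  rw [curveL2Norm, eLpNorm_eq_lintegral_rpow_enorm_toReal two_ne_zero ENNReal.ofNat_ne_top]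
  simp [hμ]

end Growth

/-! ### Uniform decay away from the closed cone -/

section Decay

open Complex Set

variable {k α : ℝ}

/-- Cauchy's estimate on a circle of radius δ|z|, which stays in the slightly larger region |arg w|
≥ ψ' where E_α already decays. -/
theorem exists_norm_deriv_mittagLeffler_le_div (hα : 0 < α) {ψ : ℝ}
    (hψ : Real.pi * α / 2 < ψ) (hψ' : ψ ≤ Real.pi) :
    ∃ C : ℝ, 0 ≤ C ∧ ∀ z : ℂ, z ≠ 0 → z.re ≤ ‖z‖ * Real.cos ψ →
      ‖z * deriv (mittagLeffler α) z‖ ≤ C / ‖z‖ := by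
  have hπ := Real.pi_pos
  obtain ⟨ψ', h1, h2⟩ := exists_between hψ
  obtain ⟨C, hC0, hC⟩ := exists_norm_mittagLeffler_le_div hα h1 (h2.le.trans hψ')
  have hψ'0 : 0 ≤ ψ' := (by positivity : 0 ≤ Real.pi * α / 2).trans h1.le
  have hcos := Real.cos_lt_cos_of_nonneg_of_le_pi hψ'0 hψ' h2
  -- A quarter of the gap covers the changes of re w and of |w| cos ψ', and also gives δ ≤ 1/2,
  -- hence |w| ≥ |z|/2.
  set δ := (Real.cos ψ' - Real.cos ψ) / 4 with hδ
  have hδ0 : 0 < δ := by linarith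
  have hc1 := Real.cos_le_one ψ'
  have hc2 := Real.neg_one_le_cos ψ
  have hc3 := Real.neg_one_le_cos ψ'
  have hδ1 : δ ≤ 1 / 2 := by linarith
  refine ⟨2 * C / δ, by positivity, fun z hz hre => ?_⟩
  have hz0 : 0 < ‖z‖ := norm_pos_iff.2 hz
  have key : ‖deriv (mittagLeffler α) z‖ ≤ (2 * C / ‖z‖) / (δ * ‖z‖) := by
    refine norm_deriv_le_of_forall_mem_sphere_norm_le (by positivity)
      (differentiable_mittagLeffler hα).diffContOnCl fun w hw => ?_
    rw [mem_sphere_iff_norm] at hw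
    have hn1 : ‖z‖ - δ * ‖z‖ ≤ ‖w‖ := by
      have := norm_sub_norm_le z w; rw [norm_sub_rev, hw] at this; linarith
    have hn2 : ‖w‖ ≤ ‖z‖ + δ * ‖z‖ := by
      have := norm_sub_norm_le w z; rw [hw] at this; linarith
    have hr : w.re ≤ z.re + δ * ‖z‖ := by
      have := (le_abs_self _).trans (abs_re_le_norm (w - z))
      rw [hw, sub_re] at this; linarith
    have hhalf : ‖z‖ / 2 ≤ ‖w‖ := by nlinarith
    have hw0 : w ≠ 0 := norm_pos_iff.1 (by linarith)
    have hcone : w.re ≤ ‖w‖ * Real.cos ψ' := by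
      have hlow : ‖z‖ * Real.cos ψ' - δ * ‖z‖ ≤ ‖w‖ * Real.cos ψ' := by
        have h3 : |‖w‖ - ‖z‖| ≤ δ * ‖z‖ := abs_le.2 ⟨by linarith, by linarith⟩
        have h4 : |(‖w‖ - ‖z‖) * Real.cos ψ'| ≤ δ * ‖z‖ * 1 := by
          rw [abs_mul]
          exact mul_le_mul h3 (Real.abs_cos_le_one _) (abs_nonneg _) (by positivity)
        have := (abs_le.1 h4).1
        linarith
      have : ‖z‖ * Real.cos ψ' - ‖z‖ * Real.cos ψ = 4 * δ * ‖z‖ := by rw [hδ]; ring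
      nlinarith
    refine (hC w hw0 hcone).trans ?_
    rw [div_le_div_iff₀ (by linarith) hz0]
    nlinarith
  rw [norm_mul]
  calc ‖z‖ * ‖deriv (mittagLeffler α) z‖ ≤ ‖z‖ * ((2 * C / ‖z‖) / (δ * ‖z‖)) := by gcongr
    _ = _ := by field_simp

/-- At z = tτ(x₁ + i x₂) the bound 1/|z| is not integrable in t near 0. Since g is bounded near the
origin, the rate can be weakened to |z|^{-1/2}, which is. -/
theorem exists_norm_le_rpow_of_le_div {g : ℂ → ℂ} (hg : Continuous g) {S : Set ℂ} {C : ℝ}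
    (hC : 0 ≤ C) (h : ∀ z ∈ S, z ≠ 0 → ‖g z‖ ≤ C / ‖z‖) :
    ∃ C' : ℝ, 0 ≤ C' ∧ ∀ z ∈ S, z ≠ 0 → ‖g z‖ ≤ C' * ‖z‖ ^ (-(1 / 2) : ℝ) := by
  obtain ⟨C₀, hC₀⟩ := (isCompact_closedBall (0 : ℂ) 1).exists_bound_of_continuousOn
    hg.continuousOn
  have hC₀0 : 0 ≤ C₀ := (norm_nonneg _).trans (hC₀ 0 (by simp))
  refine ⟨C + C₀, by positivity, fun z hz hz0 => ?_⟩
  have hn : 0 < ‖z‖ := norm_pos_iff.2 hz0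
  have hp : 0 ≤ ‖z‖ ^ (-(1 / 2) : ℝ) := by positivity
  rcases le_total ‖z‖ 1 with h1 | h1
  · have h2 : 1 ≤ ‖z‖ ^ (-(1 / 2) : ℝ) :=
      Real.one_le_rpow_of_pos_of_le_one_of_nonpos hn h1 (by norm_num)
    have h3 := hC₀ z (by simpa using h1)
    nlinarith
  · have h2 : ‖z‖⁻¹ ≤ ‖z‖ ^ (-(1 / 2) : ℝ) := by
      rw [← Real.rpow_neg_one]
      exact Real.rpow_le_rpow_of_exponent_le h1 (by norm_num)
    have h3 := h z hz hz0
    rw [div_eq_mul_inv] at h3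
    nlinarith [mul_le_mul_of_nonneg_left h2 hC, mul_nonneg hC₀0 hp]

theorem exists_norm_mittagLeffler_le_rpow (hα : 0 < α) {ψ : ℝ}
    (hψ : Real.pi * α / 2 < ψ) (hψ' : ψ ≤ Real.pi) :
    ∃ C : ℝ, 0 ≤ C ∧ ∀ z : ℂ, z ≠ 0 → z.re ≤ ‖z‖ * Real.cos ψ →
      ‖mittagLeffler α z‖ ≤ C * ‖z‖ ^ (-(1 / 2) : ℝ) ∧
      ‖z * deriv (mittagLeffler α) z‖ ≤ C * ‖z‖ ^ (-(1 / 2) : ℝ) := by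
  obtain ⟨C₁, hC₁0, hC₁⟩ := exists_norm_mittagLeffler_le_div hα hψ hψ'
  obtain ⟨C₂, hC₂0, hC₂⟩ := exists_norm_deriv_mittagLeffler_le_div hα hψ hψ'
  have hd := differentiable_mittagLeffler hα
  have hc : Continuous (deriv (mittagLeffler α)) :=
    (hd.contDiff (n := 1)).continuous_deriv le_rfl
  obtain ⟨D₁, hD₁0, hD₁⟩ := exists_norm_le_rpow_of_le_div hd.continuous
    (S := {z | z.re ≤ ‖z‖ * Real.cos ψ}) hC₁0 fun z hz hz0 => hC₁ z hz0 hz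
  obtain ⟨D₂, hD₂0, hD₂⟩ := exists_norm_le_rpow_of_le_div (continuous_id.mul hc)
    (S := {z | z.re ≤ ‖z‖ * Real.cos ψ}) hC₂0 fun z hz hz0 => hC₂ z hz0 hz
  refine ⟨D₁ + D₂, by positivity, fun z hz hre => ⟨(hD₁ z hre hz).trans ?_, (hD₂ z hre hz).trans ?_⟩⟩
  · gcongr; linarith
  · gcongr; linarith

/-- A small push along the axis moves x into the open cone: x₁ gains ε, while |x| cos θ gains at
most ε cos θ < ε. -/
theorem mem_closure_axisCone {θ : ℝ} (hθ : 0 < θ) (hθ' : θ ≤ Real.pi / 2) {x : Plane}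
    (hx : ‖x‖ * Real.cos θ ≤ x 0) : x ∈ closure (axisCone θ) := by
  have hcos : Real.cos θ < 1 := by
    rw [← Real.cos_zero]; exact Real.cos_lt_cos_of_nonneg_of_le_pi le_rfl (by linarith [Real.pi_pos]) hθ
  set e : Plane := EuclideanSpace.single 0 1
  have he : ‖e‖ = 1 := by simp [e]
  have htend : Tendsto (fun ε : ℝ => x + ε • e) (𝓝[>] 0) (𝓝 x) := by
    have : Continuous fun ε : ℝ => x + ε • e := by fun_prop
    simpa using (this.tendsto 0).mono_left nhdsWithin_le_nhds
  refine mem_closure_of_tendsto htend ?_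
  filter_upwards [self_mem_nhdsWithin] with ε hε
  have hε0 : 0 < ε := hε
  rw [mem_axisCone]
  have h0 : (x + ε • e) 0 = x 0 + ε := by simp [e]
  have h1 : ‖x + ε • e‖ ≤ ‖x‖ + ε := by
    refine (norm_add_le _ _).trans ?_
    rw [norm_smul, he, mul_one, Real.norm_of_nonneg hε0.le]
  have hc : 0 ≤ Real.cos θ := Real.cos_nonneg_of_neg_pi_div_two_le_of_le (by linarith) hθ'
  rw [h0]
  nlinarith

/-- The origin lies in the closed cone, so K avoids it. Compactness gives a smallest norm δ and a
largest cosine x₁/|x|, whose arccosine is ψ. -/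
theorem exists_angle_of_subset_compl_closure_axisCone {θ : ℝ} (hθ : 0 < θ) (hθ' : θ ≤ Real.pi / 2)
    {K : Set Plane} (hK : IsCompact K) (hsub : K ⊆ (closure (axisCone θ))ᶜ) :
    ∃ ψ δ : ℝ, θ < ψ ∧ ψ ≤ Real.pi ∧ 0 < δ ∧ ∀ x ∈ K, δ ≤ ‖x‖ ∧ x 0 ≤ ‖x‖ * Real.cos ψ := by
  rcases K.eq_empty_or_nonempty with rfl | hne
  · exact ⟨Real.pi, 1, by linarith [Real.pi_pos], le_rfl, one_pos, by simp⟩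
  have hx : ∀ x ∈ K, x 0 < ‖x‖ * Real.cos θ := fun x hx =>
    not_le.1 fun h => hsub hx (mem_closure_axisCone hθ hθ' h)
  have hpos : ∀ x ∈ K, 0 < ‖x‖ := fun x hxK => norm_pos_iff.2 fun h => by
    have := hx x hxK
    simp [h] at this
  obtain ⟨y, hyK, hy⟩ := hK.exists_isMinOn hne continuous_norm.continuousOn
  have hcont : ContinuousOn (fun x : Plane => x 0 / ‖x‖) K :=
    ContinuousOn.div (by fun_prop) (by fun_prop) fun x hx => (hpos x hx).ne'
  obtain ⟨w, hwK, hw⟩ := hK.exists_isMaxOn hne hcont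
  have habs : |w 0 / ‖w‖| ≤ 1 := by
    rw [abs_div, abs_norm, div_le_one (hpos w hwK)]
    exact PiLp.norm_apply_le w 0
  have hcosψ := Real.cos_arccos (abs_le.1 habs).1 (abs_le.1 habs).2
  refine ⟨Real.arccos (w 0 / ‖w‖), ‖y‖, ?_, Real.arccos_le_pi _, hpos y hyK, fun x hxK =>
    ⟨hy hxK, ?_⟩⟩
  · by_contra! h
    have h1 := Real.cos_le_cos_of_nonneg_of_le_pi (Real.arccos_nonneg _)
      (by linarith [Real.pi_pos]) h
    rw [hcosψ, le_div_iff₀ (hpos w hwK), mul_comm] at h1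
    exact absurd (hx w hwK) (not_lt.2 h1)
  · rw [hcosψ, mul_comm, ← div_le_iff₀ (hpos x hxK)]
    exact hw hxK

theorem norm_planeToComplex_le_one : ‖planeToComplex‖ ≤ 1 :=
  ContinuousLinearMap.opNorm_le_bound _ zero_le_one fun x => by rw [norm_planeToComplex, one_mul]

theorem hasFDerivAt_mittagLeffler_smul (hα : 0 < α) (s : ℝ) (x : Plane) :
    HasFDerivAt (fun y => mittagLeffler α (s • planeToComplex y))
      (deriv (mittagLeffler α) (s • planeToComplex x) • s • planeToComplex) x := by
  have h1 := (((differentiable_mittagLeffler hα) (s • planeToComplex x)).hasDerivAt.hasFDerivAt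
    |>.restrictScalars ℝ).comp x (s • planeToComplex).hasFDerivAt
  refine h1.congr_fderiv ?_
  ext v
  simp
  ring

theorem exists_bound_mittagLeffler_smul (hα : 0 < α) {K : Set Plane} {ψ δ : ℝ}
    (hψ : Real.pi * α / 2 < ψ) (hψ' : ψ ≤ Real.pi) (hδ : 0 < δ)
    (hK : ∀ x ∈ K, δ ≤ ‖x‖ ∧ x 0 ≤ ‖x‖ * Real.cos ψ) :
    ∃ A : ℝ, 0 ≤ A ∧ ∀ x ∈ K, ∀ s : ℝ, 0 < s →
      ‖mittagLeffler α (s • planeToComplex x)‖ ≤ A * s ^ (-(1 / 2) : ℝ) ∧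
      ‖deriv (mittagLeffler α) (s • planeToComplex x) • s • planeToComplex‖
        ≤ A * s ^ (-(1 / 2) : ℝ) := by
  obtain ⟨C, hC0, hC⟩ := exists_norm_mittagLeffler_le_rpow hα hψ hψ'
  set D := C * δ ^ (-(1 / 2) : ℝ) with hD
  have hD0 : 0 ≤ D := by positivity
  refine ⟨D + D / δ, by positivity, fun x hx s hs => ?_⟩
  obtain ⟨h1, h2⟩ := hK x hx
  have hx0 : 0 < ‖x‖ := hδ.trans_le h1
  have hn : ‖s • planeToComplex x‖ = s * ‖x‖ := by
    rw [norm_smul, norm_planeToComplex, Real.norm_of_nonneg hs.le]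
  have hne : s • planeToComplex x ≠ 0 := norm_pos_iff.1 (by rw [hn]; positivity)
  obtain ⟨h3, h4⟩ := hC _ hne (by
    rw [hn, smul_re, re_planeToComplex, smul_eq_mul, mul_assoc]; gcongr)
  have hsp : 0 ≤ s ^ (-(1 / 2) : ℝ) := by positivity
  have hb : C * ‖s • planeToComplex x‖ ^ (-(1 / 2) : ℝ) ≤ D * s ^ (-(1 / 2) : ℝ) := by
    rw [hn, Real.mul_rpow hs.le hx0.le, hD, mul_assoc, mul_comm (s ^ _)]
    refine mul_le_mul_of_nonneg_left (mul_le_mul_of_nonneg_right ?_ hsp) hC0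
    exact Real.rpow_le_rpow_of_nonpos hδ h1 (by norm_num)
  refine ⟨(h3.trans hb).trans ?_, ?_⟩
  · gcongr
    have : 0 ≤ D / δ := by positivity
    linarith
  · have h5 := h4.trans hb
    rw [norm_mul, hn] at h5
    rw [norm_smul, norm_smul, Real.norm_of_nonneg hs.le]
    set d := ‖deriv (mittagLeffler α) (s • planeToComplex x)‖
    have hd : 0 ≤ d := norm_nonneg _
    calc d * (s * ‖planeToComplex‖) ≤ d * (s * 1) := by
          gcongr; exact norm_planeToComplex_le_one
      _ = (s * δ * d) / δ := by field_simp
      _ ≤ (s * ‖x‖ * d) / δ := by gcongr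
      _ ≤ (D * s ^ (-(1 / 2) : ℝ)) / δ := by gcongr
      _ = (D / δ) * s ^ (-(1 / 2) : ℝ) := by ring
      _ ≤ _ := by gcongr; linarith

theorem norm_intervalIntegral_le_of_le_rpow {E : Type*} [NormedAddCommGroup E] [NormedSpace ℝ E]
    {f : ℝ → E} {B : ℝ} (h : ∀ t ∈ Ioc (0 : ℝ) 1, ‖f t‖ ≤ B * t ^ (-(1 / 2) : ℝ)) :
    ‖∫ t in (0 : ℝ)..1, f t‖ ≤ 2 * B := by
  have h1 : IntervalIntegrable (fun t : ℝ => B * t ^ (-(1 / 2) : ℝ)) volume 0 1 :=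
    (intervalIntegral.intervalIntegrable_rpow' (by norm_num)).const_mul B
  refine (intervalIntegral.norm_integral_le_of_norm_le zero_le_one (ae_of_all _ h) h1).trans ?_
  rw [intervalIntegral.integral_const_mul, integral_rpow (Or.inl (by norm_num))]
  norm_num
  linarith

/-- The cone condition is invariant under dilation, so the bounds for E_α and its gradient hold at
every tτz. The kernel and its x-derivative are bounded on K × [0, 1], and t^{-1/2} has integral 2.
-/
theorem exists_bound_modifiedML (k : ℝ) (hα : 0 < α) (hα1 : α ≤ 1) {K : Set Plane}
    (hK : IsCompact K) (hsub : K ⊆ (closure (axisCone (Real.pi * α / 2)))ᶜ) :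
    ∃ C : ℝ, 0 ≤ C ∧ ∀ τ : ℝ, 0 < τ → ∀ x ∈ K,
      ‖modifiedML k α τ x‖ ≤ C * τ ^ (-(1 / 2) : ℝ) ∧
      ‖fderiv ℝ (modifiedML k α τ) x‖ ≤ C * τ ^ (-(1 / 2) : ℝ) := by
  have hπ := Real.pi_pos
  obtain ⟨ψ, δ, hψ, hψ', hδ, hKψ⟩ := exists_angle_of_subset_compl_closure_axisCone
    (by positivity) (by nlinarith) hK hsub
  obtain ⟨A, hA0, hA⟩ := exists_bound_mittagLeffler_smul hα hψ hψ' hδ hKψ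
  have hcomp := hK.prod (isCompact_Icc (a := (0 : ℝ)) (b := 1))
  have hKc : ContDiff ℝ 1 (planeKernel k) := contDiff_planeKernel
  obtain ⟨M₁, hM₁⟩ := hcomp.exists_bound_of_continuousOn hKc.continuous.continuousOn
  obtain ⟨M₂, hM₂⟩ := hcomp.exists_bound_of_continuousOn
    (f := fun p => (fderiv ℝ (planeKernel k) p).comp (ContinuousLinearMap.inl ℝ Plane ℝ))
    ((hKc.continuous_fderiv one_ne_zero).clm_comp continuous_const).continuousOn
  set M := max M₁ 0 + max M₂ 0 with hM
  have hM0 : 0 ≤ M := by positivity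
  have hM1 : M₁ ≤ M := (le_max_left _ _).trans (le_add_of_nonneg_right (le_max_right _ _))
  have hM2 : M₂ ≤ M := (le_max_left _ _).trans (le_add_of_nonneg_left (le_max_right _ _))
  refine ⟨A + 2 * (A * M + M * A), by positivity, fun τ hτ x hx => ?_⟩
  set b := τ ^ (-(1 / 2) : ℝ) with hb
  have hb0 : 0 ≤ b := by positivity
  have hbt : ∀ t ∈ Ioc (0 : ℝ) 1, (t * τ) ^ (-(1 / 2) : ℝ) = b * t ^ (-(1 / 2) : ℝ) :=
    fun t ht => by rw [Real.mul_rpow ht.1.le hτ.le, mul_comm]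
  have hsm : ∀ (s : ℝ) (y : Plane), (s : ℂ) * planeToComplex y = s • planeToComplex y :=
    fun s y => real_smul.symm
  have hΨ : ∀ (t : ℝ) (y : Plane), vekuaIntegrand k α τ (y, t)
      = mittagLeffler α ((t * τ) • planeToComplex y) * planeKernel k (y, t) := fun t y => by
    rw [vekuaIntegrand, ← hsm, ofReal_mul, mul_assoc]
  have hmem : ∀ t ∈ Ioc (0 : ℝ) 1, (x, t) ∈ K ×ˢ Icc (0 : ℝ) 1 := fun t ht =>
    ⟨hx, Ioc_subset_Icc_self ht⟩
  have hint1 : ‖∫ t in (0 : ℝ)..1, vekuaIntegrand k α τ (x, t)‖ ≤ 2 * (A * M * b) := by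
    refine norm_intervalIntegral_le_of_le_rpow fun t ht => ?_
    rw [hΨ, norm_mul]
    have h1 := (hA x hx (t * τ) (mul_pos ht.1 hτ)).1
    rw [hbt t ht] at h1
    have h2 := (hM₁ _ (hmem t ht)).trans hM1
    calc _ ≤ (A * (b * t ^ (-(1 / 2) : ℝ))) * M := by
          gcongr
          have := Real.rpow_nonneg ht.1.le (-(1 / 2))
          positivity
      _ = _ := by ring
  have hDΨ : ∀ t : ℝ,
      (fderiv ℝ (vekuaIntegrand k α τ) (x, t)).comp (ContinuousLinearMap.inl ℝ Plane ℝ)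
      = mittagLeffler α ((t * τ) • planeToComplex x) •
          (fderiv ℝ (planeKernel k) (x, t)).comp (ContinuousLinearMap.inl ℝ Plane ℝ)
        + planeKernel k (x, t) • deriv (mittagLeffler α) ((t * τ) • planeToComplex x) •
          (t * τ) • planeToComplex := fun t => by
    have hin : HasFDerivAt (fun y : Plane => (y, t)) (ContinuousLinearMap.inl ℝ Plane ℝ) x :=
      (hasFDerivAt_id x).prodMk (hasFDerivAt_const t x)
    have h1 : HasFDerivAt (fun y => vekuaIntegrand k α τ (y, t))
        ((fderiv ℝ (vekuaIntegrand k α τ) (x, t)).comp (ContinuousLinearMap.inl ℝ Plane ℝ)) x :=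
      HasFDerivAt.comp (g := vekuaIntegrand k α τ) x
        (((contDiff_vekuaIntegrand hα (n := 1)).differentiable one_ne_zero) (x, t)).hasFDerivAt hin
    have h2 : HasFDerivAt (fun y => planeKernel k (y, t))
        ((fderiv ℝ (planeKernel k) (x, t)).comp (ContinuousLinearMap.inl ℝ Plane ℝ)) x :=
      HasFDerivAt.comp (g := planeKernel k) x
        ((hKc.differentiable one_ne_zero) (x, t)).hasFDerivAt hin
    simp only [hΨ] at h1
    exact h1.unique ((hasFDerivAt_mittagLeffler_smul hα (t * τ) x).mul h2)
  have hint2 : ‖∫ t in (0 : ℝ)..1,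
      (fderiv ℝ (vekuaIntegrand k α τ) (x, t)).comp (ContinuousLinearMap.inl ℝ Plane ℝ)‖
      ≤ 2 * ((A * M + M * A) * b) := by
    refine norm_intervalIntegral_le_of_le_rpow fun t ht => ?_
    obtain ⟨h1, h2⟩ := hA x hx (t * τ) (mul_pos ht.1 hτ)
    rw [hbt t ht] at h1 h2
    have h3 := (hM₁ _ (hmem t ht)).trans hM1
    have h4 := (hM₂ _ (hmem t ht)).trans hM2
    have h5 := Real.rpow_nonneg ht.1.le (-(1 / 2))
    rw [hDΨ]
    have h6 := norm_smul (mittagLeffler α ((t * τ) • planeToComplex x))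
      ((fderiv ℝ (planeKernel k) (x, t)).comp (ContinuousLinearMap.inl ℝ Plane ℝ))
    have h7 := norm_smul (planeKernel k (x, t))
      (deriv (mittagLeffler α) ((t * τ) • planeToComplex x) • (t * τ) • planeToComplex)
    refine (norm_add_le _ _).trans ?_
    rw [h6, h7]
    calc _ ≤ (A * (b * t ^ (-(1 / 2) : ℝ))) * M + M * (A * (b * t ^ (-(1 / 2) : ℝ))) := by
          gcongr
      _ = _ := by ring
  obtain ⟨h1, h2⟩ := hA x hx τ hτ
  have hAM : 0 ≤ A * M * b := by positivity
  constructor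
  · rw [modifiedML_eq_add_integral hα]
    simp only [hsm]
    refine (norm_add_le _ _).trans ((add_le_add h1 hint1).trans ?_)
    linarith
  · have h3 := (hasFDerivAt_mittagLeffler_smul hα τ x).add
      (hasFDerivAt_intervalIntegral_of_contDiff (contDiff_vekuaIntegrand (k := k) (τ := τ) hα) x)
    rw [modifiedML_eq_add_integral hα]
    simp only [hsm]
    refine (congrArg norm h3.fderiv).le.trans ?_
    refine (norm_add_le _ _).trans ((add_le_add h2 hint2).trans ?_)
    linarith

end Decay

/-! ### From uniform C¹ bounds to the Sobolev norm -/

section Sobolev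

open Set

/-- The test function is supported in U, so the integrals extend to the whole plane, where
integration by parts has no boundary term. -/
theorem isWeakPartialDeriv_fderiv {u : Plane → ℂ} (hu : ContDiff ℝ 1 u) (U : Set Plane)
    (j : Fin 2) :
    IsWeakPartialDeriv U j u fun x => fderiv ℝ u x (EuclideanSpace.single j 1) := by
  have hc : Continuous fun x => fderiv ℝ u x (EuclideanSpace.single j 1) :=
    (hu.continuous_fderiv one_ne_zero).clm_apply continuous_const
  refine ⟨hu.continuous.locallyIntegrable.locallyIntegrableOn _,
    hc.locallyIntegrable.locallyIntegrableOn _, fun φ hφ hφc hφU => ?_⟩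
  have hφ1 : ContDiff ℝ 1 φ := hφ.of_le (by exact_mod_cast le_top)
  have hφd : Continuous fun x => fderiv ℝ φ x (EuclideanSpace.single j 1) :=
    (hφ1.continuous_fderiv one_ne_zero).clm_apply continuous_const
  have hsupp : ∀ x, x ∉ U → fderiv ℝ φ x (EuclideanSpace.single j 1) = 0 := fun x hx => by
    have : x ∉ tsupport (fderiv ℝ φ) := fun h => hx (hφU (tsupport_fderiv_subset ℝ h))
    rw [image_eq_zero_of_notMem_tsupport this]; rfl
  have hsupp' : ∀ x, x ∉ U → φ x = 0 := fun x hx =>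
    image_eq_zero_of_notMem_tsupport fun h => hx (hφU h)
  have hφdc : HasCompactSupport fun x => fderiv ℝ φ x (EuclideanSpace.single j 1) :=
    hφc.fderiv_apply ℝ _
  rw [setIntegral_eq_integral_of_forall_compl_eq_zero fun x hx => by rw [hsupp x hx, mul_zero],
    setIntegral_eq_integral_of_forall_compl_eq_zero fun x hx => by rw [hsupp' x hx, mul_zero]]
  exact integral_mul_fderiv_eq_neg_fderiv_mul_of_integrable
    ((hc.mul hφ1.continuous).integrable_of_hasCompactSupport hφc.mul_left)
    ((hu.continuous.mul hφd).integrable_of_hasCompactSupport hφdc.mul_left)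
    ((hu.continuous.mul hφ1.continuous).integrable_of_hasCompactSupport hφc.mul_left)
    (fun x _ => (hu.differentiable one_ne_zero) x) (fun x _ => (hφ1.differentiable one_ne_zero) x)

/-- The `H¹(U)` norm of a `C¹` function is controlled by uniform bounds on it and its
derivative. -/
theorem sobolevH1Norm_le_of_bound {u : Plane → ℂ} (hu : ContDiff ℝ 1 u) {U : Set Plane}
    (hU : MeasurableSet U) (hUv : volume U ≠ ∞) {B : ℝ}
    (hB : ∀ x ∈ U, ‖u x‖ ≤ B ∧ ‖fderiv ℝ u x‖ ≤ B) :
    sobolevH1Norm U u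
      ≤ (3 * (volume U ^ (1 / 2 : ℝ) * ENNReal.ofReal B) ^ 2) ^ (1 / 2 : ℝ) := by
  have hfin : IsFiniteMeasure (volume.restrict U) :=
    ⟨by rw [Measure.restrict_apply_univ]; exact hUv.lt_top⟩
  set v : Fin 2 → Plane → ℂ := fun j x => fderiv ℝ u x (EuclideanSpace.single j 1) with hv
  have hvc : ∀ j, Continuous (v j) := fun j =>
    (hu.continuous_fderiv one_ne_zero).clm_apply continuous_const
  have hub : ∀ᵐ x ∂(volume.restrict U), ‖u x‖ ≤ B :=
    (ae_restrict_iff' hU).2 (ae_of_all _ fun x hx => (hB x hx).1)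
  have hvb : ∀ j, ∀ᵐ x ∂(volume.restrict U), ‖v j x‖ ≤ B := fun j =>
    (ae_restrict_iff' hU).2 (ae_of_all _ fun x hx => by
      refine ((fderiv ℝ u x).le_opNorm _).trans ?_
      rw [PiLp.norm_single, norm_one, mul_one]
      exact (hB x hx).2)
  have hgrad : HasL2WeakGradient U u v :=
    ⟨MemLp.of_bound hu.continuous.aestronglyMeasurable B hub, fun j =>
      ⟨MemLp.of_bound (hvc j).aestronglyMeasurable B (hvb j), isWeakPartialDeriv_fderiv hu U j⟩⟩
  have hLp : ∀ w : Plane → ℂ, (∀ᵐ x ∂(volume.restrict U), ‖w x‖ ≤ B) →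
      eLpNorm w 2 (volume.restrict U) ≤ volume U ^ (1 / 2 : ℝ) * ENNReal.ofReal B := fun w hw => by
    simpa using eLpNorm_le_of_ae_bound (p := 2) hw
  refine (iInf₂_le v hgrad).trans (ENNReal.rpow_le_rpow ?_ (by norm_num))
  rw [Fin.sum_univ_two]
  calc _ ≤ (volume U ^ (1 / 2 : ℝ) * ENNReal.ofReal B) ^ 2
        + ((volume U ^ (1 / 2 : ℝ) * ENNReal.ofReal B) ^ 2
          + (volume U ^ (1 / 2 : ℝ) * ENNReal.ofReal B) ^ 2) := by
        gcongr
        · exact hLp u hub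
        · exact hLp _ (hvb 0)
        · exact hLp _ (hvb 1)
    _ = _ := by ring

variable {α : ℝ}

theorem sobolevH1Norm_modifiedML (k : ℝ) (hα : 0 < α) (hα1 : α ≤ 1) {U : Set Plane}
    (hU : IsOpen U) (hUb : Bornology.IsBounded U)
    (hsub : closure U ⊆ (closure (axisCone (Real.pi * α / 2)))ᶜ) :
    (∀ τ : ℝ, 0 < τ → sobolevH1Norm U (modifiedML k α τ) < ∞) ∧
      Tendsto (fun τ : ℝ => sobolevH1Norm U (modifiedML k α τ)) atTop (𝓝 0) := by
  obtain ⟨C, -, hC⟩ := exists_bound_modifiedML k hα hα1 hUb.isCompact_closure hsub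
  have hV : volume U ≠ ∞ := hUb.measure_lt_top.ne
  have hV' : volume U ^ (1 / 2 : ℝ) ≠ ∞ := ENNReal.rpow_ne_top_of_nonneg (by norm_num) hV
  have hle : ∀ τ : ℝ, 0 < τ → sobolevH1Norm U (modifiedML k α τ) ≤ (3 * (volume U ^ (1 / 2 : ℝ)
      * ENNReal.ofReal (C * τ ^ (-(1 / 2) : ℝ))) ^ 2) ^ (1 / 2 : ℝ) := fun τ hτ =>
    sobolevH1Norm_le_of_bound (contDiff_modifiedML hα) hU.measurableSet hV
      fun x hx => hC τ hτ x (subset_closure hx)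
  refine ⟨fun τ hτ => (hle τ hτ).trans_lt ?_, ?_⟩
  · exact ENNReal.rpow_lt_top_of_nonneg (by norm_num) (ENNReal.mul_ne_top (by simp)
      (ENNReal.pow_ne_top (ENNReal.mul_ne_top hV' ENNReal.ofReal_ne_top)))
  · have h1 : Tendsto (fun τ : ℝ => C * τ ^ (-(1 / 2) : ℝ)) atTop (𝓝 0) := by
      simpa using (tendsto_rpow_neg_atTop (y := 1 / 2) (by norm_num)).const_mul C
    have h2 : Tendsto (fun τ : ℝ => volume U ^ (1 / 2 : ℝ)
        * ENNReal.ofReal (C * τ ^ (-(1 / 2) : ℝ))) atTop (𝓝 0) := by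
      simpa using ENNReal.Tendsto.const_mul (ENNReal.tendsto_ofReal h1) (Or.inr hV')
    have h3 : Tendsto (fun τ : ℝ => (3 : ℝ≥0∞) * (volume U ^ (1 / 2 : ℝ)
        * ENNReal.ofReal (C * τ ^ (-(1 / 2) : ℝ))) ^ 2) atTop (𝓝 0) := by
      simpa using ENNReal.Tendsto.const_mul (a := 3) (ENNReal.Tendsto.pow (n := 2) h2) (Or.inr (by simp))
    have h4 := (ENNReal.continuous_rpow_const (y := 1 / 2)).tendsto 0 |>.comp h3
    rw [ENNReal.zero_rpow_of_pos (by norm_num)] at h4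
    refine tendsto_of_tendsto_of_tendsto_of_le_of_le' tendsto_const_nhds h4
      (Eventually.of_forall fun _ => zero_le) ?_
    filter_upwards [eventually_gt_atTop 0] with τ hτ
    exact hle τ hτ

end Sobolev

end VekuaMittagLeffler

end

theorem corollary2p1 (k α : ℝ) (hk : 0 ≤ k) (hα : 0 < α) (hα1 : α ≤ 1) :
    (∀ c : Set VekuaMittagLeffler.Plane, VekuaMittagLeffler.IsRegularC2Curve c →
      closure c ⊆ VekuaMittagLeffler.axisCone (Real.pi * α / 2) →
      Tendsto
        (fun τ : ℝ => VekuaMittagLeffler.curveL2Norm c (VekuaMittagLeffler.modifiedML k α τ))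
        atTop (𝓝 ∞)) ∧
    (∀ U : Set VekuaMittagLeffler.Plane, IsOpen U → Bornology.IsBounded U →
      closure U ⊆ (closure (VekuaMittagLeffler.axisCone (Real.pi * α / 2)))ᶜ →
      (∀ τ : ℝ, 0 < τ →
        VekuaMittagLeffler.sobolevH1Norm U (VekuaMittagLeffler.modifiedML k α τ) < ∞) ∧
      Tendsto
        (fun τ : ℝ => VekuaMittagLeffler.sobolevH1Norm U (VekuaMittagLeffler.modifiedML k α τ))
        atTop (𝓝 0)) :=
  ⟨fun _ hc hsub => VekuaMittagLeffler.tendsto_curveL2Norm_modifiedML hα hα1 hc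
      (subset_closure.trans hsub),
    fun _ hU hUb hsub => VekuaMittagLeffler.sobolevH1Norm_modifiedML k hα hα1 hU hUb hsub⟩
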